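/- Let $N\ge 1$, $\tau>0$, $\sigma_{1i}\ge 0$, $\sigma_{2i}>0$ ($1\le i\le N$), $\Sigma_1=\mathrm{diag}(\sigma_{1i}^2)$, $\Sigma_2=\mathrm{diag}(\sigma_{2i}^2)$. Let $V\in\mathbb R^{(N-1)\times N}$ have kernel $\mathrm{span}(\mathbb 1_N)$ (for instance, $V$ gives the clock reading differences of $N-1$ pairs of clocks that connect all the clocks) and let $R\in\mathbb R^{(N-1)\times(N-1)}$ be positive definite. Put $$A(t)=\begin{bmatrix}1&t\\0&1\end{bmatrix},\quad C=\begin{bmatrix}1&0\end{bmatrix},\quad \mathbf Q(t)=\begin{bmatrix} t\Sigma_1+\frac{t^3}{3}\Sigma_2 & \frac{t^2}{2}\Sigma_2\\ \frac{t^2}{2}\Sigma_2 & t\Sigma_2\end{bmatrix},\quad A=A(\tau),\ \mathbf Q=\mathbf Q(\tau).$$ They describe the ensemble of $N$ clocks $x[k+1]=(A\otimes I_N)x[k]+v[k]$, $y[k]=(C\otimes V)x[k]+w[k]$, where the white noises $v$ and $w$ have covariances $\mathbf Q$ and $R$. Let $q\in\mathbb R^N$ be an ensemble mean weight, $q^{\mathsf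 T}\mathbb 1_N=1$, let $W\in\mathbb R^{N\times(N-1)}$ have full column rank with $q^{\mathsf T}W=0$, and let $V^+=W(VW)^{-1}$. In the explicit ensemble mean (EEM) basis with weight $q$, $x[k]=(I_2\otimes V^+)\xi_o[k]+(I_2\otimes\mathbb 1_N)\xi_{\bar o}[k]$, the determinate Kalman filter propagates prior error covariances $P^-_{oo}$ and cross covariances $P^-_{\bar oo}$ by $$\begin{aligned} H_o[k]&=P^-_{oo}[k]C_o^{\mathsf T}\bigl(C_oP^-_{oo}[k]C_o^{\mathsf T}+R\bigr)^{-1},\qquad H_{\bar o}[k]=P^-_{\bar oo}[k]C_o^{\mathsf T}\bigl(C_oP^-_{oo}[k]C_o^{\mathsf T}+R\bigr)^{-1},\\ P_{oo}[k]&=(I-H_o[k]C_o)P^-_{oo}[k],\qquad P_{\bar oo}[k]=P^-_{\bar oo}[k](I-C_o^{\mathsf T}H_o[k]^{\mathsf T}),\\ P^-_{oo}[k+1]&=A_oP_{oo}[k]A_o^{\mathsf T}+Q_o,\qquad P^-_{\bar oo}[k+1]=\bigl(\bar U(A\otimes I_N)U\,P_{oo}[k]+AP_{\bar oo}[k]\bigr)A_o^{\mathsf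 T}+Q_{\bar o}, \end{aligned}$$ where $A_o=A\otimes I_{N-1}$, $C_o=C\otimes I_{N-1}$, $U=I_2\otimes V^+$, $\bar U=I_2\otimes q^{\mathsf T}$, $Q_o=(I_2\otimes V)\mathbf Q(I_2\otimes V)^{\mathsf T}$, $Q_{\bar o}=\bar U\mathbf Q(I_2\otimes V)^{\mathsf T}$. Then the stationary prior covariances and gains $P^\star_{oo},P^\star_{\bar oo},H^\star_o,H^\star_{\bar o}$ exist, that is, $P^-_{oo}[k],P^-_{\bar oo}[k],H_o[k],H_{\bar o}[k]$ converge as $k\to\infty$ to limits that do not depend on the initial covariances ($P^-_{oo}[0]$ positive semidefinite), and $$H^\star_{\bar o}=0\iff q=q_\infty:=\frac{\Sigma_2^{-1}\mathbb 1_N}{\mathbb 1_N^{\mathsf T}\Sigma_2^{-1}\mathbb 1_N}.$$ In that case $$P^\star_{\bar oo}=\begin{bmatrix}0&-q_\infty^{\mathsf T}\Sigma_1V^{\mathsf T}\\0&0\end{bmatrix}.$$ Moreover, $q_\infty$ is the weight of best long-term Allan variance. For $t>0$ let $v$ be white noise with covariance $\mathbf Q(t)$, and for a weight $p$ let $r[k+1]=A(t)r[k]+(I_2\otimes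 p^{\mathsf T})v[k]$, $z[k]=Cr[k]$ be the free-running ensemble mean. Among all $p$ with $p^{\mathsf T}\mathbb 1_N=1$ there is exactly one, $q_{\mathsf A}(t)$, of least Allan variance $\mathbb E\bigl[(z[k+2]-2z[k+1]+z[k])^2/(2t^2)\bigr]$, and $q_{\mathsf A}(t)\to q_\infty$ as $t\to\infty$. -/

import Mathlib

open Matrix Filter Topology MeasureTheory
open scoped Kronecker

universe u

noncomputable section

/-- An ensemble of `N` second-order atomic clocks, sampled with interval `τ`, whose relative clock
readings are measured through `V` with measurement noise covariance `R`. `σ₁ i` and `σ₂ i` are the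
standard deviations of the white frequency noise and of the random walk frequency noise of clock
`i`. The `N - 1` differences of clock readings that `V` produces vanish simultaneously exactly when
all clock readings agree. -/
structure ClockEnsemble (N : ℕ) where
  τ : ℝ
  σ₁ : Fin N → ℝ
  σ₂ : Fin N → ℝ
  V : Matrix (Fin (N - 1)) (Fin N) ℝ
  R : Matrix (Fin (N - 1)) (Fin (N - 1)) ℝ
  τ_pos : 0 < τ
  σ₁_nonneg : ∀ i, 0 ≤ σ₁ i
  σ₂_pos : ∀ i, 0 < σ₂ i
  ker_V : ∀ x : Fin N → ℝ, V *ᵥ x = 0 ↔ ∃ c : ℝ, x = fun _ => c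
  R_posDef : R.PosDef

/-- The state matrix of a single clock over an interval of length `t`. -/
def clockA (t : ℝ) : Matrix (Fin 2) (Fin 2) ℝ := !![1, t; 0, 1]

/-- The output matrix of a single clock. -/
def clockC : Matrix (Fin 1) (Fin 2) ℝ := !![1, 0]

/-- `I₂ ⊗ M`. -/
def kronI {m n : Type*} (M : Matrix m n ℝ) : Matrix (Fin 2 × m) (Fin 2 × n) ℝ :=
  (1 : Matrix (Fin 2) (Fin 2) ℝ) ⊗ₖ M

/-- `C ⊗ M`; its rows are indexed by the rows of `M`. -/
def kronC {m n : Type*} (M : Matrix m n ℝ) : Matrix m (Fin 2 × n) ℝ :=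
  (clockC ⊗ₖ M).submatrix (fun i => (0, i)) id

/-- `I₂ ⊗ qᵀ`. -/
def kronRow {N : ℕ} (q : Fin N → ℝ) : Matrix (Fin 2) (Fin 2 × Fin N) ℝ :=
  (kronI (Matrix.of fun (_ : Fin 1) j => q j)).submatrix (fun i => (i, 0)) id

/-- `I₂ ⊗ 𝟙`. -/
def kronOnes (N : ℕ) : Matrix (Fin 2 × Fin N) (Fin 2) ℝ :=
  (kronRow fun _ : Fin N => (1 : ℝ))ᵀ

namespace ClockEnsemble

variable {N : ℕ} (E : ClockEnsemble N)

/-- Variances of the white frequency noises. -/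
def Sig₁ : Matrix (Fin N) (Fin N) ℝ := Matrix.diagonal fun i => E.σ₁ i ^ 2

/-- Variances of the random walk frequency noises. -/
def Sig₂ : Matrix (Fin N) (Fin N) ℝ := Matrix.diagonal fun i => E.σ₂ i ^ 2

/-- Covariance of the process noise accumulated over an interval of length `t`; its blocks are
`t Σ₁ + (t³/3) Σ₂`, `(t²/2) Σ₂`, `(t²/2) Σ₂` and `t Σ₂`. -/
def Q (t : ℝ) : Matrix (Fin 2 × Fin N) (Fin 2 × Fin N) ℝ :=
  !![t, 0; 0, 0] ⊗ₖ E.Sig₁ + !![t ^ 3 / 3, t ^ 2 / 2; t ^ 2 / 2, t] ⊗ₖ E.Sig₂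

/-- The weight `q_∞ = Σ₂⁻¹ 𝟙 / (𝟙ᵀ Σ₂⁻¹ 𝟙)`. -/
def qInf : Fin N → ℝ :=
  ((fun _ => 1) ⬝ᵥ (E.Sig₂⁻¹ *ᵥ fun _ => 1))⁻¹ • (E.Sig₂⁻¹ *ᵥ fun _ => 1)

/-! ### The determinate Kalman filter

The basis is given by `W` (`2N × 2(N-1)`, spanning a complement of the unobservable subspace) and
`Wb` (`2 × 2N`, with kernel the range of `W`). -/

/-- State matrix of the whole ensemble. -/
def bigA : Matrix (Fin 2 × Fin N) (Fin 2 × Fin N) ℝ :=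
  clockA E.τ ⊗ₖ (1 : Matrix (Fin N) (Fin N) ℝ)

/-- State matrix of the observable part. -/
def Ao : Matrix (Fin 2 × Fin (N - 1)) (Fin 2 × Fin (N - 1)) ℝ :=
  clockA E.τ ⊗ₖ (1 : Matrix (Fin (N - 1)) (Fin (N - 1)) ℝ)

/-- Output matrix of the observable part. -/
def Co (_E : ClockEnsemble N) : Matrix (Fin (N - 1)) (Fin 2 × Fin (N - 1)) ℝ :=
  kronC (1 : Matrix (Fin (N - 1)) (Fin (N - 1)) ℝ)

/-- The generalized inverse of `I₂ ⊗ V` with the range of `W`. -/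
def U (W : Matrix (Fin 2 × Fin N) (Fin 2 × Fin (N - 1)) ℝ) :
    Matrix (Fin 2 × Fin N) (Fin 2 × Fin (N - 1)) ℝ :=
  W * (kronI E.V * W)⁻¹

/-- The generalized inverse of `I₂ ⊗ 𝟙` with the kernel of `Wb`. -/
def Ub (_E : ClockEnsemble N) (Wb : Matrix (Fin 2) (Fin 2 × Fin N) ℝ) :
    Matrix (Fin 2) (Fin 2 × Fin N) ℝ :=
  (Wb * kronOnes N)⁻¹ * Wb

/-- Process noise covariance of the observable part. -/
def Qo : Matrix (Fin 2 × Fin (N - 1)) (Fin 2 × Fin (N - 1)) ℝ :=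
  kronI E.V * E.Q E.τ * (kronI E.V)ᵀ

/-- Process noise cross covariance of the unobservable and the observable parts. -/
def Qb (Wb : Matrix (Fin 2) (Fin 2 × Fin N) ℝ) : Matrix (Fin 2) (Fin 2 × Fin (N - 1)) ℝ :=
  E.Ub Wb * E.Q E.τ * (kronI E.V)ᵀ

end ClockEnsemble

/-- The covariances that the determinate filter propagates: `oo` of the observable estimation
error, `bo` of the unobservable against the observable estimation error. -/
structure ErrCov (N : ℕ) where
  oo : Matrix (Fin 2 × Fin (N - 1)) (Fin 2 × Fin (N - 1)) ℝ
  bo : Matrix (Fin 2) (Fin 2 × Fin (N - 1)) ℝ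

namespace ClockEnsemble

variable {N : ℕ} (E : ClockEnsemble N)

/-- Kalman gain of the observable part, from the prior covariances. -/
def gainO (P : ErrCov N) : Matrix (Fin 2 × Fin (N - 1)) (Fin (N - 1)) ℝ :=
  P.oo * E.Coᵀ * (E.Co * P.oo * E.Coᵀ + E.R)⁻¹

/-- Kalman gain of the unobservable part, from the prior covariances. -/
def gainB (P : ErrCov N) : Matrix (Fin 2) (Fin (N - 1)) ℝ :=
  P.bo * E.Coᵀ * (E.Co * P.oo * E.Coᵀ + E.R)⁻¹

/-- Measurement update: posterior covariances from the prior ones. -/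
def measurementUpdate (P : ErrCov N) : ErrCov N where
  oo := (1 - E.gainO P * E.Co) * P.oo
  bo := P.bo * (1 - E.Coᵀ * (E.gainO P)ᵀ)

/-- Time update: prior covariances from the preceding posterior ones. -/
def timeUpdate (W : Matrix (Fin 2 × Fin N) (Fin 2 × Fin (N - 1)) ℝ)
    (Wb : Matrix (Fin 2) (Fin 2 × Fin N) ℝ) (P : ErrCov N) : ErrCov N where
  oo := E.Ao * P.oo * E.Aoᵀ + E.Qo
  bo := (E.Ub Wb * E.bigA * E.U W * P.oo + clockA E.τ * P.bo) * E.Aoᵀ + E.Qb Wb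

/-- Prior error covariances of the determinate Kalman filter started from `P₀`. -/
def prior (W : Matrix (Fin 2 × Fin N) (Fin 2 × Fin (N - 1)) ℝ)
    (Wb : Matrix (Fin 2) (Fin 2 × Fin N) ℝ) (P₀ : ErrCov N) : ℕ → ErrCov N
  | 0 => P₀
  | k + 1 => E.timeUpdate W Wb (E.measurementUpdate (prior W Wb P₀ k))

/-- `P` and `Ho`, `Hb` are the stationary prior error covariances and the stationary Kalman gains
of the determinate Kalman filter: the limits of those of the filter, whatever the initial
covariances are. -/
structure IsStationary (W : Matrix (Fin 2 × Fin N) (Fin 2 × Fin (N - 1)) ℝ)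
    (Wb : Matrix (Fin 2) (Fin 2 × Fin N) ℝ) (P : ErrCov N)
    (Ho : Matrix (Fin 2 × Fin (N - 1)) (Fin (N - 1)) ℝ)
    (Hb : Matrix (Fin 2) (Fin (N - 1)) ℝ) : Prop where
  tendsto_oo : ∀ P₀ : ErrCov N, P₀.oo.PosSemidef →
    Tendsto (fun k => (E.prior W Wb P₀ k).oo) atTop (𝓝 P.oo)
  tendsto_bo : ∀ P₀ : ErrCov N, P₀.oo.PosSemidef →
    Tendsto (fun k => (E.prior W Wb P₀ k).bo) atTop (𝓝 P.bo)
  tendsto_gainO : ∀ P₀ : ErrCov N, P₀.oo.PosSemidef →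
    Tendsto (fun k => E.gainO (E.prior W Wb P₀ k)) atTop (𝓝 Ho)
  tendsto_gainB : ∀ P₀ : ErrCov N, P₀.oo.PosSemidef →
    Tendsto (fun k => E.gainB (E.prior W Wb P₀ k)) atTop (𝓝 Hb)

/-- The generalized inverse `V⁺ = W (V W)⁻¹` of `V`. -/
def Vplus (W : Matrix (Fin N) (Fin (N - 1)) ℝ) : Matrix (Fin N) (Fin (N - 1)) ℝ :=
  W * (E.V * W)⁻¹

end ClockEnsemble

/-! ### Allan variance of the free-running ensemble mean -/

/-- A square-integrable discrete-time white noise with covariance matrix `Q`. Gaussian white noise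
is a special case. -/
structure IsWhiteNoise {Ω ι : Type*} [MeasurableSpace Ω] (μ : Measure Ω)
    (v : ℤ → Ω → ι → ℝ) (Q : Matrix ι ι ℝ) : Prop where
  memLp : ∀ k i, MemLp (fun ω => v k ω i) 2 μ
  mean_eq_zero : ∀ k i, ∫ ω, v k ω i ∂μ = 0
  cov_eq : ∀ k i j, ∫ ω, v k ω i * v k ω j ∂μ = Q i j
  uncorrelated : ∀ k l, k ≠ l → ∀ i j, ∫ ω, v k ω i * v l ω j ∂μ = 0

/-- `r` is a state trajectory of the free-running ensemble mean with weight `p`, sampled with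
interval `t` and driven by `v`. -/
def IsFreeRunning {Ω : Type*} {N : ℕ} (t : ℝ) (p : Fin N → ℝ) (v : ℤ → Ω → Fin 2 × Fin N → ℝ)
    (r : ℤ → Ω → Fin 2 → ℝ) : Prop :=
  ∀ k ω, r (k + 1) ω = clockA t *ᵥ r k ω + kronRow p *ᵥ v k ω

/-- The Allan variance at time `k` of the clock reading `z = C r`, with sampling interval `t`. -/
def allanVariance {Ω : Type*} [MeasurableSpace Ω] (μ : Measure Ω) (t : ℝ)
    (r : ℤ → Ω → Fin 2 → ℝ) (k : ℤ) : ℝ :=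
  ∫ ω, ((clockC *ᵥ r (k + 2) ω) 0 - 2 * (clockC *ᵥ r (k + 1) ω) 0 + (clockC *ᵥ r k ω) 0) ^ 2
    / (2 * t ^ 2) ∂μ

/-- `qlim` is the weight of best long-term stability: for every sampling interval `t > 0` there is
exactly one normalized weight of least Allan variance of the free-running ensemble mean, and it
tends to `qlim` as `t → ∞`. -/
def ClockEnsemble.IsLongTermOptimal {N : ℕ} (E : ClockEnsemble N) (qlim : Fin N → ℝ) : Prop :=
  ∀ (Ω : Type u) [MeasurableSpace Ω] (μ : Measure Ω) [IsProbabilityMeasure μ]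
    (v : ℝ → ℤ → Ω → Fin 2 × Fin N → ℝ) (r : ℝ → (Fin N → ℝ) → ℤ → Ω → Fin 2 → ℝ),
    (∀ t, 0 < t → IsWhiteNoise μ (v t) (E.Q t)) →
    (∀ t, 0 < t → ∀ p, IsFreeRunning t p (v t) (r t p)) →
    ∃ qA : ℝ → Fin N → ℝ,
      (∀ t, 0 < t → ∑ i, qA t i = 1 ∧
        ∀ p : Fin N → ℝ, ∑ i, p i = 1 → p ≠ qA t →
          ∀ k, allanVariance μ t (r t (qA t)) k < allanVariance μ t (r t p) k) ∧
      Tendsto qA atTop (𝓝 qlim)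

end

/-! The observable covariance evolves on its own, by the Riccati map `Riccati.step`. Completing the
square (`joseph_eq`) exhibits this map as the Loewner minimum, over all gains, of maps affine in the
covariance. It is therefore monotone and strictly sublinear, with surplus `Q`. The pair `Ao`, `Co`
admits a deadbeat gain, so after two steps every orbit lies between `Q` and `M • Q` with `M`
independent of the start. Between these bounds the relative excess of one orbit over another shrinks
by the factor `1 - 1 / M` per step (`step_smul_bound`), so all orbits converge to one fixed point
(`exists_tendsto_iterate`).

The same bounds make the closed loops `L k` stable: `L k` maps the ellipsoid of the current
covariance into a shrunken copy of the next one (`tendsto_zero_of_closedLoop`). In the EEM basis `qᵀ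
V⁺ = 0` removes the coupling term, and the cross covariance obeys `B ↦ A B (L k)ᵀ + Qb`. As `A` is
triangular, its two rows can be treated in turn, and `B` converges to the unique stationary point
(`tendsto_crossCov`).

The stationary gain `Hb` vanishes iff `B Coᵀ = 0`. Then `Lᵀ` acts on `B` as `Aoᵀ`, and the lower
right block of the stationary equation leaves `τ qᵀ Σ₂ Vᵀ = 0`: the vector `Σ₂ q` is constant, so `q
= qInf`. Conversely, for `qInf` the claimed matrix is a stationary point with `B Coᵀ = 0`, and
uniqueness identifies it with the limit.

For the Allan variance, the second difference of the reading involves only noise and has a diagonal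
quadratic form in `p`. Its minimizer is inverse-variance weighting, in which the `σ₁` terms fade as
`t → ∞`. -/

/-! ### The Loewner order on real matrices -/

section Loewner

open scoped MatrixOrder

variable {n m : Type*}

lemma loewner_smul_le_smul {X Y : Matrix n n ℝ} (h : X ≤ Y) {a : ℝ} (ha : 0 ≤ a) :
    a • X ≤ a • Y := by
  rw [Matrix.le_iff, ← smul_sub]
  exact (Matrix.le_iff.1 h).smul ha

lemma loewner_smul_le_smul_left {X : Matrix n n ℝ} (h : 0 ≤ X) {a b : ℝ} (hab : a ≤ b) :
    a • X ≤ b • X := by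
  rw [Matrix.le_iff, ← sub_smul]
  exact h.posSemidef.smul (sub_nonneg.2 hab)

lemma loewner_smul_nonneg {X : Matrix n n ℝ} (h : 0 ≤ X) {a : ℝ} (ha : 0 ≤ a) : 0 ≤ a • X :=
  (h.posSemidef.smul ha).nonneg

variable [Fintype n] [Fintype m]

lemma quadForm_le_quadForm {X Y : Matrix n n ℝ} (h : X ≤ Y) (x : n → ℝ) :
    x ⬝ᵥ X *ᵥ x ≤ x ⬝ᵥ Y *ᵥ x := by
  have := (Matrix.le_iff.1 h).dotProduct_mulVec_nonneg x
  simpa [sub_mulVec] using this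

lemma congr_le_congr {X Y : Matrix n n ℝ} (h : X ≤ Y) (L : Matrix m n ℝ) :
    L * X * Lᵀ ≤ L * Y * Lᵀ := by
  have := (Matrix.le_iff.1 h).mul_mul_conjTranspose_same L
  rw [Matrix.le_iff]
  simpa [Matrix.mul_sub, Matrix.sub_mul, conjTranspose_eq_transpose_of_trivial] using this

lemma congr_nonneg {X : Matrix n n ℝ} (h : 0 ≤ X) (L : Matrix m n ℝ) : 0 ≤ L * X * Lᵀ := by
  simpa using congr_le_congr h L

lemma exists_le_smul_one [DecidableEq n] {X : Matrix n n ℝ} (hX : X.IsHermitian) :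
    ∃ M : ℝ, X ≤ M • (1 : Matrix n n ℝ) := by
  refine ⟨∑ i, ∑ j, |X i j|, Matrix.le_iff.2 (.of_dotProduct_mulVec_nonneg ?_ fun x => ?_)⟩
  · rw [IsHermitian, conjTranspose_sub, hX.eq]; simp
  · have hx : ∀ i j, x i * (X i j * x j) ≤ |X i j| * (x ⬝ᵥ x) := fun i j => by
      have hsq : ∀ k, x k * x k ≤ x ⬝ᵥ x := fun k =>
        Finset.single_le_sum (f := fun k => x k * x k) (fun l _ => mul_self_nonneg _)
          (Finset.mem_univ k)
      have h1 : |x i * x j| ≤ x ⬝ᵥ x := by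
        rw [abs_le]
        constructor <;> nlinarith [hsq i, hsq j, sq_nonneg (x i + x j), sq_nonneg (x i - x j)]
      calc x i * (X i j * x j) = X i j * (x i * x j) := by ring
        _ ≤ |X i j * (x i * x j)| := le_abs_self _
        _ = |X i j| * |x i * x j| := abs_mul _ _
        _ ≤ _ := by gcongr
    have h2 : x ⬝ᵥ X *ᵥ x ≤ (∑ i, ∑ j, |X i j|) * (x ⬝ᵥ x) := by
      simp only [Finset.sum_mul]
      simp only [dotProduct, mulVec, Finset.mul_sum] at hx ⊢
      exact Finset.sum_le_sum fun i _ => Finset.sum_le_sum fun j _ => hx i j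
    simp only [star_trivial, sub_mulVec, dotProduct_sub, smul_mulVec, one_mulVec, dotProduct_smul,
      smul_eq_mul]
    linarith

/-- Factoring `Q = Bᵀ B`, a congruence by `B⁻¹` reduces to `Q = 1`. The bound `1 ≤ M` puts `1 - 1 /
M` in `[0, 1)`, where it serves as a contraction factor. -/
lemma exists_le_smul_of_posDef {X Q : Matrix n n ℝ} (hX : 0 ≤ X) (hQ : Q.PosDef) :
    ∃ M : ℝ, 1 ≤ M ∧ X ≤ M • Q := by
  classical
  obtain ⟨B, hB⟩ := CStarAlgebra.nonneg_iff_eq_star_mul_self.mp hQ.posSemidef.nonneg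
  have hBu : IsUnit B := by
    have := hQ.isUnit
    rw [hB] at this
    rw [Matrix.isUnit_iff_isUnit_det] at this ⊢
    rw [det_mul] at this
    exact isUnit_of_mul_isUnit_right this
  have hd := (Matrix.isUnit_iff_isUnit_det _).1 hBu
  have hY : 0 ≤ (B⁻¹)ᵀ * X * B⁻¹ := by simpa using congr_nonneg hX (B⁻¹)ᵀ
  obtain ⟨M, hM⟩ := exists_le_smul_one hY.posSemidef.isHermitian
  refine ⟨max 1 M, le_max_left _ _, ?_⟩
  have h1 := congr_le_congr hM Bᵀ
  have h2 : Bᵀ * ((B⁻¹)ᵀ * X * B⁻¹) * Bᵀᵀ = X := by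
    rw [transpose_transpose]
    calc Bᵀ * ((B⁻¹)ᵀ * X * B⁻¹) * B = (B⁻¹ * B)ᵀ * X * (B⁻¹ * B) := by
          simp only [transpose_mul, Matrix.mul_assoc]
      _ = X := by simp [nonsing_inv_mul _ hd]
  rw [h2] at h1
  refine h1.trans ?_
  have h3 : Bᵀ * (M • (1 : Matrix n n ℝ)) * Bᵀᵀ = M • Q := by
    rw [hB, star_eq_conjTranspose, conjTranspose_eq_transpose_of_trivial]; simp
  rw [h3]
  exact loewner_smul_le_smul_left hQ.posSemidef.nonneg (le_max_right _ _)

/-- Entries of a symmetric matrix are controlled by the diagonal of a matrix that dominates it. -/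
lemma abs_apply_le_of_loewner_bounds {D S : Matrix n n ℝ} (h1 : D ≤ S) (h2 : -D ≤ S)
    (hD : D.IsHermitian) (i j : n) : |D i j| ≤ (S i i + S j j) / 2 := by
  classical
  let e : n → n → ℝ := fun k => Pi.single k 1
  have key : ∀ a b : n, e a ⬝ᵥ D *ᵥ e b = D a b := fun a b => by simp [e]
  have keyS : ∀ a b : n, e a ⬝ᵥ S *ᵥ e b = S a b := fun a b => by simp [e]
  have hs : D j i = D i j := by simpa using hD.apply i j
  -- Polarization: `4 D i j` is the difference of the forms of `D` at `e i + e j` and `e i - e j`,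
  -- while those of `S` add up to `2 (S i i + S j j)`.
  have q1 := quadForm_le_quadForm h1 (e i + e j)
  have q2 := quadForm_le_quadForm h1 (e i - e j)
  have q3 := quadForm_le_quadForm h2 (e i + e j)
  have q4 := quadForm_le_quadForm h2 (e i - e j)
  simp only [neg_mulVec, dotProduct_neg, mulVec_add, mulVec_sub, add_dotProduct, sub_dotProduct,
    dotProduct_add, dotProduct_sub, key, keyS, hs] at q1 q2 q3 q4
  rw [abs_le]
  constructor <;> linarith

end Loewner

/-! ### The Riccati recursion -/

namespace Riccati

open scoped MatrixOrder

variable {n m : Type*} [Fintype n] [Fintype m] [DecidableEq n] [DecidableEq m]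
  (A : Matrix n n ℝ) (C : Matrix m n ℝ) (Q : Matrix n n ℝ) (R : Matrix m m ℝ)

/-- The Kalman gain in predictor form. -/
noncomputable def gain (P : Matrix n n ℝ) : Matrix n m ℝ := A * (P * Cᵀ * (C * P * Cᵀ + R)⁻¹)

/-- The Riccati map. -/
noncomputable def step (P : Matrix n n ℝ) : Matrix n n ℝ :=
  A * ((1 - P * Cᵀ * (C * P * Cᵀ + R)⁻¹ * C) * P) * Aᵀ + Q

/-- The error covariance that an arbitrary gain `K` produces. -/
noncomputable def joseph (K : Matrix n m ℝ) (P : Matrix n n ℝ) : Matrix n n ℝ :=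
  (A - K * C) * P * (A - K * C)ᵀ + (K * R * Kᵀ + Q)

/-- The closed-loop matrix of the optimal gain. -/
noncomputable def closedLoop (P : Matrix n n ℝ) : Matrix n n ℝ := A - gain A C R P * C

variable {A C Q R}

lemma posDef_innovation {n m : Type*} [Fintype n] [Fintype m] {C : Matrix m n ℝ}
    {R : Matrix m m ℝ} (hR : R.PosDef) {P : Matrix n n ℝ} (hP : 0 ≤ P) :
    (C * P * Cᵀ + R).PosDef :=
  Matrix.PosDef.posSemidef_add (congr_nonneg hP C).posSemidef hR

lemma transpose_eq_of_isHermitian {k : Type*} {P : Matrix k k ℝ} (hP : P.IsHermitian) : Pᵀ = P := by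
  rw [← conjTranspose_eq_transpose_of_trivial]; exact hP

/-- Completing the square in `K`: the Kalman gain is optimal in the Loewner order. -/
lemma joseph_eq (hR : R.PosDef) {P : Matrix n n ℝ} (hP : 0 ≤ P) (K : Matrix n m ℝ) :
    joseph A C Q R K P = step A C Q R P +
      (K - gain A C R P) * (C * P * Cᵀ + R) * (K - gain A C R P)ᵀ := by
  have hS := posDef_innovation (C := C) hR hP
  have hPt := transpose_eq_of_isHermitian hP.posSemidef.isHermitian
  have hSt := transpose_eq_of_isHermitian hS.isHermitian
  have hd := (Matrix.isUnit_iff_isUnit_det _).1 hS.isUnit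
  have hRS : R = (C * P * Cᵀ + R) - C * P * Cᵀ := by abel
  unfold joseph step gain
  generalize hSS : C * P * Cᵀ + R = S at *
  have hGt : (S⁻¹)ᵀ = S⁻¹ := by rw [transpose_nonsing_inv, hSt]
  have h1 : ∀ X : Matrix m n ℝ, S * (S⁻¹ * X) = X := fun X => mul_nonsing_inv_cancel_left _ _ hd
  have h2 : ∀ X : Matrix m n ℝ, S⁻¹ * (S * X) = X := fun X => nonsing_inv_mul_cancel_left _ _ hd
  rw [hRS]
  simp only [transpose_sub, transpose_mul, transpose_transpose, hPt, hGt, Matrix.mul_sub,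
    Matrix.sub_mul, Matrix.mul_assoc, Matrix.one_mul, h1, h2]
  abel

lemma step_le_joseph (hR : R.PosDef) {P : Matrix n n ℝ} (hP : 0 ≤ P) (K : Matrix n m ℝ) :
    step A C Q R P ≤ joseph A C Q R K P := by
  rw [joseph_eq hR hP]
  exact le_add_of_nonneg_right (congr_nonneg (posDef_innovation hR hP).posSemidef.nonneg _)

lemma step_eq_joseph (hR : R.PosDef) {P : Matrix n n ℝ} (hP : 0 ≤ P) :
    step A C Q R P = joseph A C Q R (gain A C R P) P := by
  rw [joseph_eq hR hP]; simp

lemma joseph_mono {n m : Type*} [Fintype n] [Fintype m] {A : Matrix n n ℝ} {C : Matrix m n ℝ}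
    {Q : Matrix n n ℝ} {R : Matrix m m ℝ} {X Y : Matrix n n ℝ} (h : X ≤ Y) (K : Matrix n m ℝ) :
    joseph A C Q R K X ≤ joseph A C Q R K Y :=
  add_le_add_left (congr_le_congr h _) _

/-- The gain optimal for `Y` is admissible for `X`. -/
lemma step_mono (hR : R.PosDef) {X Y : Matrix n n ℝ} (hX : 0 ≤ X) (h : X ≤ Y) :
    step A C Q R X ≤ step A C Q R Y :=
  (step_le_joseph hR hX _).trans <|
    (joseph_mono h _).trans_eq (step_eq_joseph hR (hX.trans h)).symm

lemma closedLoop_add_le_step (hR : R.PosDef) {P : Matrix n n ℝ} (hP : 0 ≤ P) :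
    closedLoop A C R P * P * (closedLoop A C R P)ᵀ + Q ≤ step A C Q R P := by
  rw [step_eq_joseph hR hP, joseph, closedLoop]
  refine add_le_add_right ?_ _
  exact le_add_of_nonneg_left (congr_nonneg hR.posSemidef.nonneg _)

lemma le_step (hR : R.PosDef) {P : Matrix n n ℝ} (hP : 0 ≤ P) : Q ≤ step A C Q R P :=
  (le_add_of_nonneg_left (congr_nonneg hP _)).trans (closedLoop_add_le_step hR hP)

lemma step_nonneg (hQ : Q.PosDef) (hR : R.PosDef) {P : Matrix n n ℝ} (hP : 0 ≤ P) :
    0 ≤ step A C Q R P := hQ.posSemidef.nonneg.trans (le_step hR hP)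

/-- The Riccati map is strictly sublinear. -/
lemma step_smul_le (hR : R.PosDef) {P : Matrix n n ℝ} (hP : 0 ≤ P) {b : ℝ} (hb : 0 ≤ b) :
    step A C Q R ((1 + b) • P) + b • Q ≤ (1 + b) • step A C Q R P := by
  -- With the gain of `P` kept, the Joseph form is affine in the covariance; scaling `P` alone does
  -- not scale the constant `K R Kᵀ + Q`, which saves `b` times it.
  have h := step_le_joseph (A := A) (C := C) (Q := Q) hR
    (loewner_smul_nonneg hP (by linarith : 0 ≤ 1 + b)) (gain A C R P)
  refine (add_le_add_left h _).trans ?_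
  rw [step_eq_joseph hR hP]
  unfold joseph
  generalize gain A C R P = K
  have hK : 0 ≤ b • (K * R * Kᵀ) :=
    loewner_smul_nonneg (congr_nonneg hR.posSemidef.nonneg _) hb
  rw [← sub_nonneg]
  convert hK using 1
  simp only [Matrix.mul_smul, Matrix.smul_mul]
  module

/-- The surplus `b • Q` of sublinearity is at least the fraction `b / M` of `step Y`. -/
lemma step_smul_bound (hR : R.PosDef) {X Y : Matrix n n ℝ} (hX : 0 ≤ X) (hY : 0 ≤ Y) {b M : ℝ}
    (hb : 0 ≤ b) (hM : 1 ≤ M) (hYM : step A C Q R Y ≤ M • Q) (h : X ≤ (1 + b) • Y) :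
    step A C Q R X ≤ (1 + b * (1 - 1 / M)) • step A C Q R Y := by
  have h1 := (add_le_add_left (step_mono (A := A) (C := C) (Q := Q) hR hX h) (b • Q)).trans
    (step_smul_le hR hY hb)
  have hMp : 0 < M := by linarith
  have h2 := loewner_smul_le_smul hYM (by positivity : 0 ≤ b / M)
  rw [smul_smul, div_mul_cancel₀ _ hMp.ne'] at h2
  have h3 : step A C Q R X ≤ (1 + b) • step A C Q R Y - b • Q := le_sub_iff_add_le.2 h1
  refine h3.trans ((sub_le_sub_left h2 _).trans_eq ?_)
  module

/-- Two steps of the Riccati recursion lead below a bound which does not depend on the initial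
value, provided there is a deadbeat gain. -/
lemma exists_step_step_le (hQ : Q.PosDef) (hR : R.PosDef) {K : Matrix n m ℝ}
    (hK : (A - K * C) * (A - K * C) = 0) :
    ∃ M : ℝ, 1 ≤ M ∧ ∀ P : Matrix n n ℝ, 0 ≤ P → step A C Q R (step A C Q R P) ≤ M • Q := by
  set S := K * R * Kᵀ + Q
  have hS : 0 ≤ S := add_nonneg (congr_nonneg hR.posSemidef.nonneg _) hQ.posSemidef.nonneg
  obtain ⟨M, hM, h⟩ := exists_le_smul_of_posDef
    (add_nonneg (congr_nonneg hS (A - K * C)) hS) hQ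
  refine ⟨M, hM, fun P hP => ?_⟩
  have h1 := step_le_joseph (A := A) (C := C) (Q := Q) hR hP K
  have h2 := step_le_joseph (A := A) (C := C) (Q := Q) hR (step_nonneg (A := A) (C := C) hQ hR hP) K
  refine h2.trans ((joseph_mono h1 K).trans (le_trans (le_of_eq ?_) h))
  -- Under the deadbeat gain `P` enters the second step only through this product, so it disappears.
  have h3 : (A - K * C)ᵀ * (A - K * C)ᵀ = 0 := by rw [← transpose_mul, hK, transpose_zero]
  unfold joseph
  rw [Matrix.mul_add, Matrix.add_mul]
  congr 1
  rw [add_eq_right, Matrix.mul_assoc, Matrix.mul_assoc (_ * P), h3]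
  simp

end Riccati

lemma tendsto_zero_of_le_mul_add {r e : ℕ → ℝ} {θ : ℝ} (h0 : 0 ≤ θ) (h1 : θ < 1)
    (hr : ∀ k, 0 ≤ r k) (h : ∀ k, r (k + 1) ≤ θ * r k + e k) (he : Tendsto e atTop (𝓝 0)) :
    Tendsto r atTop (𝓝 0) := by
  rw [Metric.tendsto_atTop]
  intro ε hε
  have hpos : 0 < (1 - θ) * (ε / 2) := mul_pos (by linarith) (by linarith)
  -- `ε / 2` is the fixed point of `s ↦ θ * s + (1 - θ) * (ε / 2)`.
  obtain ⟨N, hN⟩ := (he.eventually (gt_mem_nhds hpos)).exists_forall_of_atTop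
  have hb : ∀ j, r (N + j) ≤ ε / 2 + θ ^ j * r N := by
    intro j
    induction j with
    | zero => simp; linarith
    | succ j ih =>
      have h2 := h (N + j)
      have h3 := hN (N + j) (Nat.le_add_right _ _)
      have h4 := mul_le_mul_of_nonneg_left ih h0
      rw [← add_assoc, pow_succ]
      linarith
  have ht : Tendsto (fun j => θ ^ j * r N) atTop (𝓝 0) := by
    simpa using (tendsto_pow_atTop_nhds_zero_of_lt_one h0 h1).mul_const (r N)
  obtain ⟨J, hJ⟩ := (ht.eventually (gt_mem_nhds (half_pos hε))).exists_forall_of_atTop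
  refine ⟨N + J, fun k hk => ?_⟩
  have h5 := hb (k - N)
  have h6 := hJ (k - N) (by omega)
  rw [show N + (k - N) = k by omega] at h5
  rw [Real.dist_eq, sub_zero, abs_of_nonneg (hr k)]
  linarith

namespace Riccati

open scoped MatrixOrder

variable {n m : Type*} [Fintype n] [Fintype m] [DecidableEq n] [DecidableEq m]
  {A : Matrix n n ℝ} {C : Matrix m n ℝ} {Q : Matrix n n ℝ} {R : Matrix m m ℝ}

/-! #### Convergence -/

lemma iterate_nonneg (hQ : Q.PosDef) (hR : R.PosDef) {P : Matrix n n ℝ} (hP : 0 ≤ P) (k : ℕ) :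
    0 ≤ (step A C Q R)^[k] P := by
  induction k with
  | zero => exact hP
  | succ k ih => rw [Function.iterate_succ_apply']; exact step_nonneg hQ hR ih

lemma iterate_le (hQ : Q.PosDef) (hR : R.PosDef) {M : ℝ}
    (hM : ∀ P : Matrix n n ℝ, 0 ≤ P → step A C Q R (step A C Q R P) ≤ M • Q)
    {P : Matrix n n ℝ} (hP : 0 ≤ P) (k : ℕ) : (step A C Q R)^[k + 2] P ≤ M • Q := by
  rw [Function.iterate_succ_apply', Function.iterate_succ_apply']
  exact hM _ (iterate_nonneg hQ hR hP k)

lemma le_iterate (hQ : Q.PosDef) (hR : R.PosDef) {P : Matrix n n ℝ} (hP : 0 ≤ P) (k : ℕ) :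
    Q ≤ (step A C Q R)^[k + 1] P := by
  rw [Function.iterate_succ_apply']
  exact le_step hR (iterate_nonneg hQ hR hP k)

/-- After two steps both orbits lie between `Q` and `M • Q`, so the initial excess is at most `M -
1`. -/
lemma iterate_le_smul_iterate (hQ : Q.PosDef) (hR : R.PosDef) {M : ℝ} (hM1 : 1 ≤ M)
    (hM : ∀ P : Matrix n n ℝ, 0 ≤ P → step A C Q R (step A C Q R P) ≤ M • Q)
    {X Y : Matrix n n ℝ} (hX : 0 ≤ X) (hY : 0 ≤ Y) (k : ℕ) :
    (step A C Q R)^[k + 2] X ≤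
      (1 + (M - 1) * (1 - 1 / M) ^ k) • (step A C Q R)^[k + 2] Y := by
  have hc : 0 ≤ 1 - 1 / M := by
    rw [sub_nonneg, div_le_one (by linarith)]; exact hM1
  induction k with
  | zero =>
    refine (iterate_le hQ hR hM hX 0).trans ?_
    have := loewner_smul_le_smul (le_iterate (A := A) (C := C) hQ hR hY 1)
      (by linarith : 0 ≤ M)
    simpa using this
  | succ k ih =>
    have hb : step A C Q R ((step A C Q R)^[k + 2] Y) ≤ M • Q := by
      rw [← Function.iterate_succ_apply' (step A C Q R)]
      exact iterate_le hQ hR hM hY (k + 1)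
    have h := step_smul_bound (A := A) (C := C) (Q := Q) (M := M) hR
      (iterate_nonneg hQ hR hX (k + 2))
      (iterate_nonneg hQ hR hY (k + 2)) (by have := pow_nonneg hc k; nlinarith) hM1 hb ih
    rw [show k + 1 + 2 = (k + 2) + 1 by ring, Function.iterate_succ_apply' _ (k + 2),
      Function.iterate_succ_apply' _ (k + 2), pow_succ, ← mul_assoc]
    exact h

lemma abs_iterate_sub_le (hQ : Q.PosDef) (hR : R.PosDef) {M : ℝ} (hM1 : 1 ≤ M)
    (hM : ∀ P : Matrix n n ℝ, 0 ≤ P → step A C Q R (step A C Q R P) ≤ M • Q)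
    {X Y : Matrix n n ℝ} (hX : 0 ≤ X) (hY : 0 ≤ Y) (k : ℕ) (i j : n) :
    |((step A C Q R)^[k + 2] X) i j - ((step A C Q R)^[k + 2] Y) i j| ≤
      (M - 1) * M * ((Q i i + Q j j) / 2) * (1 - 1 / M) ^ k := by
  have hc : 0 ≤ 1 - 1 / M := by
    rw [sub_nonneg, div_le_one (by linarith)]; exact hM1
  have hb : 0 ≤ (M - 1) * (1 - 1 / M) ^ k := mul_nonneg (by linarith) (pow_nonneg hc k)
  have key : ∀ {X Y : Matrix n n ℝ}, 0 ≤ X → 0 ≤ Y →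
      (step A C Q R)^[k + 2] X - (step A C Q R)^[k + 2] Y ≤
        ((M - 1) * (1 - 1 / M) ^ k * M) • Q := by
    intro X Y hX hY
    have h1 := iterate_le_smul_iterate hQ hR hM1 hM hX hY k
    have h2 := loewner_smul_le_smul (iterate_le hQ hR hM hY k) hb
    rw [add_smul, one_smul] at h1
    rw [smul_smul] at h2
    exact sub_le_iff_le_add'.2 (h1.trans (add_le_add_right h2 _))
  have h3 := abs_apply_le_of_loewner_bounds (key hX hY)
    (by rw [neg_sub]; exact key hY hX)
    ((iterate_nonneg hQ hR hX (k + 2)).posSemidef.isHermitian.sub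
      (iterate_nonneg hQ hR hY (k + 2)).posSemidef.isHermitian) i j
  refine h3.trans_eq ?_
  simp only [Matrix.smul_apply, smul_eq_mul]
  ring

/-- The innovation covariance can be inverted continuously. -/
lemma continuousAt_inv_innovation {n m : Type*} [Fintype n] [Fintype m] [DecidableEq m]
    {C : Matrix m n ℝ} {R : Matrix m m ℝ} (hR : R.PosDef) {P : Matrix n n ℝ} (hP : 0 ≤ P) :
    ContinuousAt (fun X : Matrix n n ℝ => (C * X * Cᵀ + R)⁻¹) P := by
  have hd := (posDef_innovation (C := C) hR hP).det_pos.ne'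
  have h1 : ContinuousAt Ring.inverse (C * P * Cᵀ + R).det := by
    rw [Ring.inverse_eq_inv']
    exact continuousAt_inv₀ hd
  have h2 : ContinuousAt (fun X : Matrix n n ℝ => C * X * Cᵀ + R) P := by fun_prop
  exact ContinuousAt.comp (g := Inv.inv) (continuousAt_matrix_inv _ h1) h2

lemma tendsto_mul_inv_innovation {n m l ι : Type*} [Fintype n] [Fintype m] [DecidableEq m]
    {C : Matrix m n ℝ} {R : Matrix m m ℝ} (hR : R.PosDef) {P : Matrix n n ℝ} (hP : 0 ≤ P)
    {F : Filter ι} {X : ι → Matrix l n ℝ} {Y : Matrix l n ℝ} {Z : ι → Matrix n n ℝ}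
    (hX : Tendsto X F (𝓝 Y)) (hZ : Tendsto Z F (𝓝 P)) :
    Tendsto (fun k => X k * Cᵀ * (C * Z k * Cᵀ + R)⁻¹) F
      (𝓝 (Y * Cᵀ * (C * P * Cᵀ + R)⁻¹)) := by
  have hc : Continuous fun T : Matrix l n ℝ × Matrix m m ℝ => T.1 * Cᵀ * T.2 := by fun_prop
  have h1 : Tendsto (fun k => (C * Z k * Cᵀ + R)⁻¹) F (𝓝 (C * P * Cᵀ + R)⁻¹) :=
    (continuousAt_inv_innovation hR hP).tendsto.comp hZ
  have h2 := hX.prodMk_nhds h1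
  have h3 := hc.tendsto (Y, (C * P * Cᵀ + R)⁻¹)
  have h4 := h3.comp h2
  simpa only [Function.comp_def] using h4

lemma continuousAt_step (hR : R.PosDef) {P : Matrix n n ℝ} (hP : 0 ≤ P) :
    ContinuousAt (step A C Q R) P := by
  have := continuousAt_inv_innovation (C := C) hR hP
  unfold step
  fun_prop

lemma continuousAt_closedLoop {n m : Type*} [Fintype n] [Fintype m] [DecidableEq m]
    {A : Matrix n n ℝ} {C : Matrix m n ℝ} {R : Matrix m m ℝ} (hR : R.PosDef) {P : Matrix n n ℝ} (hP : 0 ≤ P) :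
    ContinuousAt (closedLoop A C R) P := by
  have := continuousAt_inv_innovation (C := C) hR hP
  unfold closedLoop gain
  fun_prop

lemma isClosed_nonneg {n : Type*} [Fintype n] : IsClosed {P : Matrix n n ℝ | 0 ≤ P} := by
  have : {P : Matrix n n ℝ | 0 ≤ P} =
      {P | Pᵀ = P} ∩ ⋂ x : n → ℝ, {P | 0 ≤ x ⬝ᵥ P *ᵥ x} := by
    ext P
    simp [Matrix.nonneg_iff_posSemidef, posSemidef_iff_dotProduct_mulVec, IsHermitian,
      conjTranspose_eq_transpose_of_trivial]
  rw [this]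
  refine (isClosed_eq (by fun_prop) (by fun_prop)).inter (isClosed_iInter fun x => ?_)
  exact isClosed_le (by fun_prop) (by fun_prop)

/-- With positive definite noise covariances and a deadbeat gain, the Riccati recursion converges
to the same positive semidefinite fixed point from every positive semidefinite initial value. -/
theorem exists_tendsto_iterate (hQ : Q.PosDef) (hR : R.PosDef) {K : Matrix n m ℝ}
    (hK : (A - K * C) * (A - K * C) = 0) :
    ∃ P : Matrix n n ℝ, 0 ≤ P ∧ step A C Q R P = P ∧
      ∀ X : Matrix n n ℝ, 0 ≤ X → Tendsto (fun k => (step A C Q R)^[k] X) atTop (𝓝 P) := by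
  obtain ⟨M, hM1, hM⟩ := exists_step_step_le (A := A) (C := C) hQ hR hK
  have hM0 : 0 < M := by linarith
  have hc0 : 0 ≤ 1 - 1 / M := by
    rw [sub_nonneg, div_le_one hM0]; exact hM1
  have hc1 : 1 - 1 / M < 1 := by
    have : 0 < 1 / M := by positivity
    linarith
  have hz : (0 : Matrix n n ℝ) ≤ 0 := le_rfl
  have hcs : ∀ i j, ∃ p, Tendsto (fun k => ((step A C Q R)^[k + 2] 0) i j) atTop (𝓝 p) := by
    intro i j
    refine cauchySeq_tendsto_of_complete (cauchySeq_of_le_geometric _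
      ((M - 1) * M * ((Q i i + Q j j) / 2)) hc1 fun k => ?_)
    rw [Real.dist_eq]
    -- Starting from `step 0` shifts the orbit of `0` by one, so comparing the two bounds
    -- consecutive iterates.
    have := abs_iterate_sub_le hQ hR hM1 hM hz (step_nonneg (A := A) (C := C) hQ hR hz) k i j
    rwa [← Function.iterate_succ_apply (step A C Q R)] at this
  choose P hP using hcs
  have hlim : ∀ X : Matrix n n ℝ, 0 ≤ X →
      Tendsto (fun k => (step A C Q R)^[k] X) atTop (𝓝 (of P)) := by
    intro X hX
    rw [← tendsto_add_atTop_iff_nat 2]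
    refine tendsto_pi_nhds.2 fun i => tendsto_pi_nhds.2 fun j => ?_
    have h0 : Tendsto (fun k => ((step A C Q R)^[k + 2] X) i j - ((step A C Q R)^[k + 2] 0) i j)
        atTop (𝓝 0) := by
      refine squeeze_zero_norm (fun k => abs_iterate_sub_le hQ hR hM1 hM hX hz k i j) ?_
      simpa using (tendsto_pow_atTop_nhds_zero_of_lt_one hc0 hc1).const_mul
        ((M - 1) * M * ((Q i i + Q j j) / 2))
    simpa using h0.add (hP i j)
  have hpos : (0 : Matrix n n ℝ) ≤ of P :=
    isClosed_nonneg.mem_of_tendsto (hlim 0 hz)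
      (Eventually.of_forall fun k => iterate_nonneg hQ hR hz k)
  refine ⟨of P, hpos, ?_, hlim⟩
  refine tendsto_nhds_unique ?_ ((tendsto_add_atTop_iff_nat 1).2 (hlim 0 hz))
  simp only [Function.iterate_succ_apply']
  exact (continuousAt_step hR hpos).tendsto.comp (hlim 0 hz)

/-! #### Stability of the closed loop -/

/-- `x` lies in `r` times the ellipsoid of the covariance `P`. -/
def InEllipsoid (P : Matrix n n ℝ) (r : ℝ) (x : n → ℝ) : Prop :=
  ∀ y : n → ℝ, |y ⬝ᵥ x| ≤ r * √(y ⬝ᵥ P *ᵥ y)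

lemma InEllipsoid.mono {n : Type*} [Fintype n] {P P' : Matrix n n ℝ} {r : ℝ} {x : n → ℝ}
    (h : InEllipsoid P r x) (hr : 0 ≤ r) (hP : P ≤ P') : InEllipsoid P' r x := fun y =>
  (h y).trans (mul_le_mul_of_nonneg_left (Real.sqrt_le_sqrt (quadForm_le_quadForm hP y)) hr)

lemma InEllipsoid.add {n : Type*} [Fintype n] {P : Matrix n n ℝ} {r s : ℝ} {x z : n → ℝ}
    (hx : InEllipsoid P r x) (hz : InEllipsoid P s z) : InEllipsoid P (r + s) (x + z) := fun y => by
  rw [dotProduct_add, add_mul]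
  exact (abs_add_le _ _).trans (add_le_add (hx y) (hz y))

lemma InEllipsoid.mulVec {n : Type*} [Fintype n] {P P' L : Matrix n n ℝ} {r c : ℝ}
    {x : n → ℝ} (h : InEllipsoid P r x) (hr : 0 ≤ r) (hc : 0 ≤ c) (hL : L * P * Lᵀ ≤ c • P') :
    InEllipsoid P' (√c * r) (L *ᵥ x) := fun y => by
  have h1 := h (Lᵀ *ᵥ y)
  have h2 := quadForm_le_quadForm hL y
  have h3 : y ⬝ᵥ (L * P * Lᵀ) *ᵥ y = (Lᵀ *ᵥ y) ⬝ᵥ P *ᵥ (Lᵀ *ᵥ y) := by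
    rw [← mulVec_mulVec, ← mulVec_mulVec, dotProduct_mulVec y, ← mulVec_transpose]
  rw [h3, smul_mulVec, dotProduct_smul, smul_eq_mul] at h2
  rw [dotProduct_mulVec, ← mulVec_transpose]
  refine h1.trans ?_
  calc _ ≤ r * √(c * (y ⬝ᵥ P' *ᵥ y)) := by gcongr
    _ = _ := by rw [Real.sqrt_mul hc]; ring

lemma exists_inEllipsoid (hQ : Q.PosDef) :
    ∃ κ : ℝ, 0 ≤ κ ∧ ∀ x, InEllipsoid Q (κ * √(x ⬝ᵥ x)) x := by
  obtain ⟨M, hM1, hM⟩ := exists_le_smul_of_posDef (X := 1) Matrix.PosSemidef.one.nonneg hQ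
  refine ⟨√M, Real.sqrt_nonneg _, fun x y => ?_⟩
  have h1 := quadForm_le_quadForm hM y
  rw [one_mulVec, smul_mulVec, dotProduct_smul, smul_eq_mul] at h1
  have h2 : (y ⬝ᵥ x) ^ 2 ≤ (y ⬝ᵥ y) * (x ⬝ᵥ x) := by
    simpa [dotProduct, sq] using Finset.sum_mul_sq_le_sq_mul_sq Finset.univ y x
  have hxx : 0 ≤ x ⬝ᵥ x := Finset.sum_nonneg fun i _ => mul_self_nonneg _
  have h3 : (y ⬝ᵥ x) ^ 2 ≤ M * (x ⬝ᵥ x) * (y ⬝ᵥ Q *ᵥ y) := by nlinarith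
  calc |y ⬝ᵥ x| ≤ √(M * (x ⬝ᵥ x) * (y ⬝ᵥ Q *ᵥ y)) := Real.abs_le_sqrt h3
    _ = _ := by
      rw [Real.sqrt_mul (by positivity), Real.sqrt_mul (by linarith)]

/-- A linear recursion driven by the closed loop of the filter and by a vanishing input tends
to zero. -/
theorem tendsto_zero_of_closedLoop (hQ : Q.PosDef) (hR : R.PosDef) {K : Matrix n m ℝ}
    (hK : (A - K * C) * (A - K * C) = 0) {X : Matrix n n ℝ} (hX : 0 ≤ X) {b u : ℕ → n → ℝ}
    (hb : ∀ k, b (k + 1) = closedLoop A C R ((step A C Q R)^[k] X) *ᵥ b k + u k)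
    (hu : Tendsto u atTop (𝓝 0)) : Tendsto b atTop (𝓝 0) := by
  obtain ⟨M, hM1, hM⟩ := exists_step_step_le (A := A) (C := C) hQ hR hK
  obtain ⟨κ, hκ0, hκ⟩ := exists_inEllipsoid hQ
  have hM0 : 0 < M := by linarith
  have hc0 : 0 ≤ 1 - 1 / M := by
    rw [sub_nonneg, div_le_one hM0]; exact hM1
  have hc1 : 1 - 1 / M < 1 := by
    have : 0 < 1 / M := by positivity
    linarith
  -- With `P k` the iterates, `L P k Lᵀ ≤ P (k + 1) - Q`, and `Q` is at least `P (k + 1) / M`.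
  have hL : ∀ k, closedLoop A C R ((step A C Q R)^[k + 2] X) * (step A C Q R)^[k + 2] X *
      (closedLoop A C R ((step A C Q R)^[k + 2] X))ᵀ ≤
        (1 - 1 / M) • (step A C Q R)^[k + 1 + 2] X := by
    intro k
    have h1 := closedLoop_add_le_step (A := A) (C := C) (Q := Q) hR
      (iterate_nonneg (A := A) (C := C) hQ hR hX (k + 2))
    rw [← Function.iterate_succ_apply' (step A C Q R)] at h1
    have h2 := loewner_smul_le_smul (iterate_le hQ hR hM hX (k + 1))
      (by positivity : 0 ≤ 1 / M)
    rw [smul_smul, one_div_mul_cancel hM0.ne', one_smul] at h2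
    rw [sub_smul, one_smul]
    exact (le_sub_iff_add_le.2 h1).trans (sub_le_sub_left h2 _)
  -- Radius of an ellipsoid, relative to the iterate `k + 2`, that contains `b (k + 2)`.
  let r : ℕ → ℝ := fun k => k.rec (κ * √(b 2 ⬝ᵥ b 2))
    fun k s => √(1 - 1 / M) * s + κ * √(u (k + 2) ⬝ᵥ u (k + 2))
  have hr0 : ∀ k, 0 ≤ r k := by
    intro k
    induction k with
    | zero => exact mul_nonneg hκ0 (Real.sqrt_nonneg _)
    | succ k ih =>
      exact add_nonneg (mul_nonneg (Real.sqrt_nonneg _) ih) (mul_nonneg hκ0 (Real.sqrt_nonneg _))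
  have hQP : ∀ k, Q ≤ (step A C Q R)^[k + 2] X := fun k => le_iterate hQ hR hX (k + 1)
  have hin : ∀ k, InEllipsoid ((step A C Q R)^[k + 2] X) (r k) (b (k + 2)) := by
    intro k
    induction k with
    | zero => exact (hκ _).mono (hr0 0) (hQP 0)
    | succ k ih =>
      rw [show k + 1 + 2 = (k + 2) + 1 by ring, hb]
      exact (ih.mulVec (hr0 k) hc0 (hL k)).add
        ((hκ _).mono (mul_nonneg hκ0 (Real.sqrt_nonneg _)) (hQP (k + 1)))
  have hu2 : Tendsto (fun k => u (k + 2)) atTop (𝓝 0) := (tendsto_add_atTop_iff_nat 2).2 hu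
  have hrt : Tendsto r atTop (𝓝 0) := by
    refine tendsto_zero_of_le_mul_add (Real.sqrt_nonneg (1 - 1 / M))
      (by rw [Real.sqrt_lt' one_pos]; simpa using hc1) hr0 (fun k => le_rfl) ?_
    have hcont : Continuous fun x : n → ℝ => κ * √(x ⬝ᵥ x) := by fun_prop
    simpa [Function.comp_def] using (hcont.tendsto 0).comp hu2
  rw [← tendsto_add_atTop_iff_nat 2]
  refine tendsto_pi_nhds.2 fun i => ?_
  refine squeeze_zero_norm (a := fun k => r k * √(M * Q i i)) (fun k => ?_)
    (by simpa using hrt.mul_const (√(M * Q i i)))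
  have h1 := hin k (Pi.single i 1)
  have h2 := quadForm_le_quadForm (iterate_le hQ hR hM hX k) (Pi.single i 1)
  rw [single_one_dotProduct] at h1
  refine h1.trans (mul_le_mul_of_nonneg_left (Real.sqrt_le_sqrt (h2.trans_eq ?_)) (hr0 k))
  simp

/-- The closed loop of a fixed point of the Riccati map has no eigenvalue one. -/
theorem exists_eq_closedLoop_mulVec_add (hQ : Q.PosDef) (hR : R.PosDef) {K : Matrix n m ℝ}
    (hK : (A - K * C) * (A - K * C) = 0) {P : Matrix n n ℝ} (hP : 0 ≤ P)
    (hfix : step A C Q R P = P) (u : n → ℝ) : ∃ x, x = closedLoop A C R P *ᵥ x + u := by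
  have hinj : Function.Injective (1 - closedLoop A C R P).mulVecLin := by
    rw [← LinearMap.ker_eq_bot, LinearMap.ker_eq_bot']
    intro x hx
    have hx' : x = closedLoop A C R P *ᵥ x := by
      simpa [sub_mulVec, sub_eq_zero] using hx
    -- A fixed vector is a constant orbit, which stability forces to vanish.
    have := tendsto_zero_of_closedLoop (b := fun _ => x) (u := fun _ => 0) hQ hR hK hP
      (fun k => by rw [Function.iterate_fixed hfix, add_zero]; exact hx') tendsto_const_nhds
    exact tendsto_nhds_unique tendsto_const_nhds this
  obtain ⟨x, hx⟩ := LinearMap.injective_iff_surjective.1 hinj u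
  refine ⟨x, ?_⟩
  rw [← hx]
  simp

end Riccati

/-! ### The cross covariance recursion -/

namespace Riccati

open scoped MatrixOrder

variable {n m : Type*} [Fintype n] [Fintype m] [DecidableEq n] [DecidableEq m]
  {A : Matrix n n ℝ} {C : Matrix m n ℝ} {Q : Matrix n n ℝ} {R : Matrix m m ℝ}

lemma clockA_mul_mul_transpose_zero {n : Type*} [Fintype n] (t : ℝ) (B : Matrix (Fin 2) n ℝ)
    (L : Matrix n n ℝ) :
    (clockA t * B * Lᵀ) 0 = L *ᵥ (B 0 + t • B 1) := by
  ext j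
  simp only [clockA, Matrix.mul_apply, mulVec, dotProduct, Fin.sum_univ_two, transpose_apply]
  simp [mul_comm]

lemma clockA_mul_mul_transpose_one {n : Type*} [Fintype n] (t : ℝ) (B : Matrix (Fin 2) n ℝ)
    (L : Matrix n n ℝ) :
    (clockA t * B * Lᵀ) 1 = L *ᵥ B 1 := by
  ext j
  simp only [clockA, Matrix.mul_apply, mulVec, dotProduct, Fin.sum_univ_two, transpose_apply]
  simp [mul_comm]

/-- Back substitution: row 1 is autonomous, and row 0 sees row 1 only as an input. -/
lemma exists_crossCov_fixedPoint (hQ : Q.PosDef) (hR : R.PosDef) {K : Matrix n m ℝ}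
    (hK : (A - K * C) * (A - K * C) = 0) {P : Matrix n n ℝ} (hP : 0 ≤ P)
    (hfix : step A C Q R P = P) (t : ℝ) (G : Matrix (Fin 2) n ℝ) :
    ∃ B : Matrix (Fin 2) n ℝ, B = clockA t * B * (closedLoop A C R P)ᵀ + G := by
  obtain ⟨b, hb⟩ := exists_eq_closedLoop_mulVec_add hQ hR hK hP hfix (G 1)
  obtain ⟨a, ha⟩ := exists_eq_closedLoop_mulVec_add hQ hR hK hP hfix
    (closedLoop A C R P *ᵥ (t • b) + G 0)
  let B : Matrix (Fin 2) n ℝ := of ![a, b]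
  refine ⟨B, ?_⟩
  funext i
  fin_cases i
  · change a = (clockA t * B * (closedLoop A C R P)ᵀ) 0 + G 0
    rw [clockA_mul_mul_transpose_zero]
    change a = closedLoop A C R P *ᵥ (a + t • b) + G 0
    rw [mulVec_add, add_assoc]
    exact ha
  · change b = (clockA t * B * (closedLoop A C R P)ᵀ) 1 + G 1
    rw [clockA_mul_mul_transpose_one]
    exact hb

/-- The cross covariance recursion converges to any of its stationary points. -/
theorem tendsto_crossCov (hQ : Q.PosDef) (hR : R.PosDef) {K : Matrix n m ℝ}
    (hK : (A - K * C) * (A - K * C) = 0) {P X : Matrix n n ℝ} (hP : 0 ≤ P) (hX : 0 ≤ X)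
    (hlim : Tendsto (fun k => (step A C Q R)^[k] X) atTop (𝓝 P)) {t : ℝ}
    {G B : Matrix (Fin 2) n ℝ} (hB : B = clockA t * B * (closedLoop A C R P)ᵀ + G)
    {b : ℕ → Matrix (Fin 2) n ℝ}
    (hb : ∀ k, b (k + 1) =
      clockA t * b k * (closedLoop A C R ((step A C Q R)^[k] X))ᵀ + G) :
    Tendsto b atTop (𝓝 B) := by
  set L : ℕ → Matrix n n ℝ := fun k => closedLoop A C R ((step A C Q R)^[k] X) with hLdef
  have hL : Tendsto L atTop (𝓝 (closedLoop A C R P)) :=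
    (continuousAt_closedLoop hR hP).tendsto.comp hlim
  have hLx : ∀ x : n → ℝ,
      Tendsto (fun k => (L k - closedLoop A C R P) *ᵥ x) atTop (𝓝 0) := by
    intro x
    have hc : Continuous fun Y : Matrix n n ℝ => (Y - closedLoop A C R P) *ᵥ x := by fun_prop
    simpa [Function.comp_def] using (hc.tendsto _).comp hL
  have e1 : ∀ k, b (k + 1) 1 = L k *ᵥ b k 1 + G 1 := fun k => by
    rw [← clockA_mul_mul_transpose_one t, hb k]; rfl
  have e0 : ∀ k, b (k + 1) 0 = L k *ᵥ (b k 0 + t • b k 1) + G 0 := fun k => by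
    rw [← clockA_mul_mul_transpose_zero t, hb k]; rfl
  have f1 : B 1 = closedLoop A C R P *ᵥ B 1 + G 1 := by
    rw [← clockA_mul_mul_transpose_one t]; exact congrFun hB 1
  have f0 : B 0 = closedLoop A C R P *ᵥ (B 0 + t • B 1) + G 0 := by
    rw [← clockA_mul_mul_transpose_zero t]; exact congrFun hB 0
  have h1 : Tendsto (fun k => b k 1 - B 1) atTop (𝓝 0) := by
    -- The deviation from `B` obeys the same recursion; its input, due to `L k` differing from its
    -- limit, vanishes.
    refine tendsto_zero_of_closedLoop hQ hR hK hX
      (u := fun k => (L k - closedLoop A C R P) *ᵥ B 1) (fun k => ?_) (hLx _)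
    change b (k + 1) 1 - B 1 = L k *ᵥ (b k 1 - B 1) + _
    rw [e1, mulVec_sub, sub_mulVec]
    nth_rewrite 1 [f1]
    abel
  have h0 : Tendsto (fun k => b k 0 - B 0) atTop (𝓝 0) := by
    refine tendsto_zero_of_closedLoop hQ hR hK hX
      (u := fun k => (L k - closedLoop A C R P) *ᵥ (B 0 + t • B 1) +
        L k *ᵥ (t • (b k 1 - B 1))) (fun k => ?_) ?_
    · change b (k + 1) 0 - B 0 = L k *ᵥ (b k 0 - B 0) + _
      rw [e0]
      nth_rewrite 1 [f0]
      simp only [mulVec_sub, sub_mulVec, mulVec_add, mulVec_smul, smul_sub]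
      abel
    · have hc : Continuous fun Y : Matrix n n ℝ × (n → ℝ) => Y.1 *ᵥ (t • Y.2) := by fun_prop
      have := (hc.tendsto (closedLoop A C R P, 0)).comp (hL.prodMk_nhds h1)
      simpa [Function.comp_def] using (hLx (B 0 + t • B 1)).add this
  refine tendsto_pi_nhds.2 fun i => ?_
  rw [← tendsto_sub_nhds_zero_iff]
  fin_cases i
  · exact h0
  · exact h1

end Riccati

/-! ### Kronecker products with small matrices -/

lemma kronRow_apply {N : ℕ} (q : Fin N → ℝ) (i b : Fin 2) (l : Fin N) :
    kronRow q i (b, l) = if i = b then q l else 0 := by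
  simp [kronRow, kronI, Matrix.one_apply]

lemma kronI_apply {m n : Type*} (M : Matrix m n ℝ) (a b : Fin 2) (j : m) (l : n) :
    kronI M (a, j) (b, l) = if a = b then M j l else 0 := by
  simp [kronI, Matrix.one_apply]

lemma kronRow_mul_kronOnes {N : ℕ} {q : Fin N → ℝ} (hq : ∑ i, q i = 1) :
    kronRow q * kronOnes N = 1 := by
  ext i j
  simp only [kronOnes, Matrix.mul_apply, Fintype.sum_prod_type, transpose_apply, kronRow_apply,
    Fin.sum_univ_two, Matrix.one_apply]
  fin_cases i <;> fin_cases j <;> simp [hq]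

namespace ClockEnsemble

variable {N : ℕ} (E : ClockEnsemble N)

lemma Ub_kronRow {q : Fin N → ℝ} (hq : ∑ i, q i = 1) : E.Ub (kronRow q) = kronRow q := by
  rw [Ub, kronRow_mul_kronOnes hq, inv_one, Matrix.one_mul]

/-- `A` acts on the state index and `q`, `V⁺` on the clock index, so the product contains the factor
`qᵀ V⁺ = 0`. -/
lemma Ub_mul_bigA_mul_U {q : Fin N → ℝ} (hq : ∑ i, q i = 1)
    {W : Matrix (Fin N) (Fin (N - 1)) ℝ} (hqW : q ᵥ* W = 0) :
    E.Ub (kronRow q) * E.bigA * E.U (kronI (E.Vplus W)) = 0 := by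
  have h : q ᵥ* E.Vplus W = 0 := by rw [Vplus, ← vecMul_vecMul, hqW, zero_vecMul]
  have h2 : kronRow q * E.bigA * kronI (E.Vplus W) = 0 := by
    ext i ⟨a, j⟩
    have hj := congrFun h j
    simp only [vecMul, dotProduct, Pi.zero_apply] at hj
    simp only [bigA, Matrix.mul_apply, Fintype.sum_prod_type, kronRow_apply, kronI_apply,
      kroneckerMap_apply, Matrix.one_apply, Fin.sum_univ_two, Matrix.zero_apply]
    fin_cases i <;> fin_cases a <;> simp [hj, mul_right_comm _ (E.τ), ← Finset.sum_mul, clockA]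
  rw [Ub_kronRow E hq, U, ← Matrix.mul_assoc, h2, Matrix.zero_mul]

/-! ### Deadbeat gain and noise covariance of the observable part -/

lemma Co_apply (j : Fin (N - 1)) (a : Fin 2) (l : Fin (N - 1)) :
    E.Co j (a, l) = if a = 0 ∧ j = l then 1 else 0 := by
  fin_cases a <;> simp [Co, kronC, clockC, Matrix.one_apply]

/-- A gain that makes the closed loop nilpotent. -/
noncomputable def deadbeatGain : Matrix (Fin 2 × Fin (N - 1)) (Fin (N - 1)) ℝ :=
  of fun i j => if i.2 = j then ![2, 1 / E.τ] i.1 else 0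

/-- The entries `2` and `1 / τ` of the gain make the trace and the determinant of the `2 × 2` factor
vanish. -/
lemma Ao_sub_deadbeatGain_mul_Co :
    E.Ao - E.deadbeatGain * E.Co =
      !![-1, E.τ; -(1 / E.τ), 1] ⊗ₖ (1 : Matrix (Fin (N - 1)) (Fin (N - 1)) ℝ) := by
  ext ⟨a, j⟩ ⟨b, l⟩
  simp only [Ao, deadbeatGain, Matrix.sub_apply, Matrix.mul_apply, Co_apply, of_apply,
    kroneckerMap_apply, Matrix.one_apply, clockA]
  fin_cases a <;> fin_cases b <;> by_cases h : j = l <;> simp [h]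
  norm_num

lemma deadbeat :
    (E.Ao - E.deadbeatGain * E.Co) * (E.Ao - E.deadbeatGain * E.Co) = 0 := by
  have hτ := E.τ_pos.ne'
  rw [Ao_sub_deadbeatGain_mul_Co, ← mul_kronecker_mul]
  have : !![-1, E.τ; -(1 / E.τ), 1] * !![-1, E.τ; -(1 / E.τ), 1] = 0 := by
    ext i j
    fin_cases i <;> fin_cases j <;> simp [Matrix.mul_apply, Fin.sum_univ_two, hτ]
  rw [this, zero_kronecker]

/-- The random walk part alone is definite; the `σ₁ i` may vanish. -/
lemma Q_posDef {t : ℝ} (ht : 0 < t) : (E.Q t).PosDef := by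
  have h1 : (!![t, 0; 0, 0] : Matrix (Fin 2) (Fin 2) ℝ).PosSemidef := by
    refine .of_dotProduct_mulVec_nonneg ?_ fun x => ?_
    · ext i j; fin_cases i <;> fin_cases j <;> simp
    · simp [dotProduct, mulVec, Fin.sum_univ_two]
      nlinarith [mul_self_nonneg (x 0)]
  have h2 : (!![t ^ 3 / 3, t ^ 2 / 2; t ^ 2 / 2, t] : Matrix (Fin 2) (Fin 2) ℝ).PosDef := by
    refine .of_dotProduct_mulVec_pos ?_ fun x hx => ?_
    · ext i j; fin_cases i <;> fin_cases j <;> simp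
    · simp only [dotProduct, mulVec, Fin.sum_univ_two, star_trivial, of_apply, cons_val',
        cons_val_zero, cons_val_one, cons_val_fin_one]
      have e : x 0 * (t ^ 3 / 3 * x 0 + t ^ 2 / 2 * x 1) +
          x 1 * (t ^ 2 / 2 * x 0 + t * x 1) =
          t * ((x 1 + t / 2 * x 0) ^ 2 + t ^ 2 / 12 * x 0 ^ 2) := by ring
      rw [e]
      refine mul_pos ht ?_
      by_cases h0 : x 0 = 0
      · have h1 : x 1 ≠ 0 := fun h1 => hx (by ext i; fin_cases i <;> simp [h0, h1])
        simp only [h0, mul_zero, add_zero]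
        positivity
      · positivity
  exact Matrix.PosDef.posSemidef_add
    (h1.kronecker (.diagonal fun i => sq_nonneg (E.σ₁ i)))
    (h2.kronecker (.diagonal fun i => pow_pos (E.σ₂_pos i) 2))

/-- Rank-nullity: the kernel is the line of constant vectors. -/
lemma V_mulVec_surjective (hN : N ≠ 0) : Function.Surjective E.V.mulVec := by
  have hker : Module.finrank ℝ (LinearMap.ker E.V.mulVecLin) = 1 := by
    have : LinearMap.ker E.V.mulVecLin = Submodule.span ℝ {fun _ => (1 : ℝ)} := by
      ext x
      rw [LinearMap.mem_ker, mulVecLin_apply, E.ker_V, Submodule.mem_span_singleton]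
      constructor
      · rintro ⟨c, rfl⟩; exact ⟨c, by ext; simp⟩
      · rintro ⟨c, rfl⟩; exact ⟨c, by ext; simp⟩
    rw [this]
    exact finrank_span_singleton fun h => one_ne_zero (congrFun h ⟨0, Nat.pos_of_ne_zero hN⟩)
  have h := E.V.mulVecLin.finrank_range_add_finrank_ker
  rw [hker, Module.finrank_fin_fun] at h
  have : LinearMap.range E.V.mulVecLin = ⊤ := by
    apply Submodule.eq_top_of_finrank_eq
    rw [Module.finrank_fin_fun]; omega
  exact LinearMap.range_eq_top.1 this

lemma V_vecMul_injective (hN : N ≠ 0) : Function.Injective E.V.vecMul := by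
  intro x y h
  have h0 : (x - y) ᵥ* E.V = 0 := by
    rw [sub_vecMul, sub_eq_zero]; exact h
  obtain ⟨z, hz⟩ := E.V_mulVec_surjective hN (x - y)
  have : (x - y) ⬝ᵥ (x - y) = 0 :=
    calc (x - y) ⬝ᵥ (x - y) = (x - y) ⬝ᵥ E.V *ᵥ z := by rw [hz]
      _ = 0 := by rw [dotProduct_mulVec, h0, zero_dotProduct]
  exact sub_eq_zero.1 (dotProduct_self_eq_zero.1 this)

lemma Qo_posDef (hN : N ≠ 0) : E.Qo.PosDef := by
  have := (E.Q_posDef E.τ_pos).mul_mul_conjTranspose_same (B := kronI E.V) ?_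
  · simpa [Qo, conjTranspose_eq_transpose_of_trivial] using this
  · intro x y h
    have key : ∀ (z : Fin 2 × Fin (N - 1) → ℝ) (a : Fin 2) (l : Fin N),
        (z ᵥ* kronI E.V) (a, l) = ((fun j => z (a, j)) ᵥ* E.V) l := by
      intro z a l
      simp only [vecMul, dotProduct, Fintype.sum_prod_type, kronI_apply]
      fin_cases a <;> simp
    ext ⟨a, j⟩
    have h2 : (fun j => x (a, j)) ᵥ* E.V = (fun j => y (a, j)) ᵥ* E.V := by
      ext l
      rw [← key, ← key]; exact congrFun h _
    exact congrFun (E.V_vecMul_injective hN h2) j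

/-! ### The weight `qInf` and the noise cross covariance in coordinates -/

lemma qInf_apply (l : Fin N) : E.qInf l = (E.σ₂ l ^ 2)⁻¹ / ∑ i, (E.σ₂ i ^ 2)⁻¹ := by
  have h : E.Sig₂⁻¹ = diagonal fun i => (E.σ₂ i ^ 2)⁻¹ := by
    refine inv_eq_right_inv ?_
    rw [Sig₂, diagonal_mul_diagonal, ← diagonal_one]
    congr 1
    ext i
    exact mul_inv_cancel₀ (pow_pos (E.σ₂_pos i) 2).ne'
  simp [qInf, h, dotProduct, mulVec_diagonal, div_eq_inv_mul]

lemma Qb_apply {q : Fin N → ℝ} (hq : ∑ i, q i = 1) (i a : Fin 2) (j : Fin (N - 1)) :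
    E.Qb (kronRow q) i (a, j) =
      (!![E.τ, 0; 0, 0] : Matrix (Fin 2) (Fin 2) ℝ) i a * (q ᵥ* (E.Sig₁ * E.Vᵀ)) j +
      (!![E.τ ^ 3 / 3, E.τ ^ 2 / 2; E.τ ^ 2 / 2, E.τ] : Matrix (Fin 2) (Fin 2) ℝ) i a *
        (q ᵥ* (E.Sig₂ * E.Vᵀ)) j := by
  have h1 : kronRow q * E.Q E.τ =
      of fun i b => (!![E.τ, 0; 0, 0] : Matrix (Fin 2) (Fin 2) ℝ) i b.1 * (q b.2 * E.σ₁ b.2 ^ 2) +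
      (!![E.τ ^ 3 / 3, E.τ ^ 2 / 2; E.τ ^ 2 / 2, E.τ] : Matrix (Fin 2) (Fin 2) ℝ) i b.1 *
        (q b.2 * E.σ₂ b.2 ^ 2) := by
    ext i ⟨b, l⟩
    simp only [Matrix.mul_apply, Fintype.sum_prod_type, kronRow_apply, Q, Matrix.add_apply,
      kroneckerMap_apply, Sig₁, Sig₂, diagonal_apply, of_apply]
    simp only [ite_mul, zero_mul, mul_ite, mul_zero, mul_add, Finset.sum_add_distrib,
      Finset.sum_ite_eq', Finset.mem_univ, if_true, Fin.sum_univ_two]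
    fin_cases i <;> simp <;> ring
  have h2 : ∀ d : Fin N → ℝ,
      (q ᵥ* (diagonal d * E.Vᵀ)) j = ∑ l, q l * d l * E.V j l := fun d => by
    simp [vecMul, dotProduct, diagonal_mul, mul_assoc]
  rw [Qb, Ub_kronRow E hq, h1, Sig₁, Sig₂, h2, h2]
  simp only [Matrix.mul_apply, Fintype.sum_prod_type, transpose_apply, kronI_apply, of_apply,
    Finset.mul_sum, ← Finset.sum_add_distrib]
  fin_cases a <;> simp only [Fin.sum_univ_two] <;> simp <;>
    exact Finset.sum_congr rfl fun l _ => by ring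

lemma mul_Ao_transpose_apply (B : Matrix (Fin 2) (Fin 2 × Fin (N - 1)) ℝ) (i a : Fin 2)
    (j : Fin (N - 1)) :
    (B * E.Aoᵀ) i (a, j) = clockA E.τ a 0 * B i (0, j) + clockA E.τ a 1 * B i (1, j) := by
  simp only [Ao, Matrix.mul_apply, Fintype.sum_prod_type, transpose_apply, kroneckerMap_apply,
    Matrix.one_apply, Fin.sum_univ_two]
  simp [mul_comm]

lemma mul_Co_transpose_apply (B : Matrix (Fin 2) (Fin 2 × Fin (N - 1)) ℝ) (i : Fin 2)
    (j : Fin (N - 1)) : (B * E.Coᵀ) i j = B i (0, j) := by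
  simp [Matrix.mul_apply, Fintype.sum_prod_type, Co_apply, Fin.sum_univ_two]

/-- The left side says that `Σ₂ q` lies in the kernel of `V`, hence is constant; normalization fixes
the constant. -/
lemma vecMul_Sig₂_eq_zero_iff {q : Fin N → ℝ} (hq : ∑ i, q i = 1) :
    q ᵥ* (E.Sig₂ * E.Vᵀ) = 0 ↔ q = E.qInf := by
  have h1 : q ᵥ* (E.Sig₂ * E.Vᵀ) = E.V *ᵥ fun l => q l * E.σ₂ l ^ 2 := by
    rw [← vecMul_vecMul, vecMul_transpose]
    congr 1
    ext l
    simp [Sig₂, vecMul_diagonal]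
  have hpos : ∀ l, E.σ₂ l ^ 2 ≠ 0 := fun l => (pow_pos (E.σ₂_pos l) 2).ne'
  rw [h1, E.ker_V]
  constructor
  · rintro ⟨c, hc⟩
    have h2 : ∀ l, q l = c * (E.σ₂ l ^ 2)⁻¹ := fun l => by
      rw [← div_eq_mul_inv, eq_div_iff (hpos l)]; exact congrFun hc l
    have h3 : c * ∑ i, (E.σ₂ i ^ 2)⁻¹ = 1 := by
      rw [← hq, Finset.mul_sum]; exact Finset.sum_congr rfl fun l _ => (h2 l).symm
    ext l
    rw [qInf_apply, h2, div_eq_mul_inv, eq_inv_of_mul_eq_one_left h3, mul_comm]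
  · rintro rfl
    refine ⟨(∑ i, (E.σ₂ i ^ 2)⁻¹)⁻¹, ?_⟩
    ext l
    rw [qInf_apply, div_mul_eq_mul_div, inv_mul_cancel₀ (hpos l), one_div]

end ClockEnsemble

namespace ClockEnsemble

open scoped MatrixOrder

variable {N : ℕ} (E : ClockEnsemble N)

/-! ### The determinate filter in the EEM basis -/

lemma prior_oo (W : Matrix (Fin 2 × Fin N) (Fin 2 × Fin (N - 1)) ℝ)
    (Wb : Matrix (Fin 2) (Fin 2 × Fin N) ℝ) (P₀ : ErrCov N) (k : ℕ) :
    (E.prior W Wb P₀ k).oo = (Riccati.step E.Ao E.Co E.Qo E.R)^[k] P₀.oo := by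
  induction k with
  | zero => rfl
  | succ k ih => rw [Function.iterate_succ_apply', ← ih]; rfl

lemma prior_bo_succ {W : Matrix (Fin 2 × Fin N) (Fin 2 × Fin (N - 1)) ℝ}
    {Wb : Matrix (Fin 2) (Fin 2 × Fin N) ℝ} (h : E.Ub Wb * E.bigA * E.U W = 0)
    (P₀ : ErrCov N) (k : ℕ) :
    (E.prior W Wb P₀ (k + 1)).bo = clockA E.τ * (E.prior W Wb P₀ k).bo *
      (Riccati.closedLoop E.Ao E.Co E.R
        ((Riccati.step E.Ao E.Co E.Qo E.R)^[k] P₀.oo))ᵀ + E.Qb Wb := by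
  rw [← prior_oo E W Wb]
  change (E.Ub Wb * E.bigA * E.U W * _ + clockA E.τ * ((E.prior W Wb P₀ k).bo *
    (1 - E.Coᵀ * (E.gainO (E.prior W Wb P₀ k))ᵀ))) * E.Aoᵀ + E.Qb Wb = _
  have hcl : Riccati.closedLoop E.Ao E.Co E.R (E.prior W Wb P₀ k).oo =
      E.Ao * (1 - E.gainO (E.prior W Wb P₀ k) * E.Co) := by
    rw [Matrix.mul_sub, Matrix.mul_one, ← Matrix.mul_assoc]; rfl
  rw [h, hcl, Matrix.zero_mul, zero_add, transpose_mul, transpose_sub, transpose_mul,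
    transpose_one]
  simp only [Matrix.mul_assoc]

lemma mul_closedLoop_transpose_of_mul_Co_transpose_eq_zero
    {B : Matrix (Fin 2) (Fin 2 × Fin (N - 1)) ℝ} (h : B * E.Coᵀ = 0)
    (P : Matrix (Fin 2 × Fin (N - 1)) (Fin 2 × Fin (N - 1)) ℝ) :
    B * (Riccati.closedLoop E.Ao E.Co E.R P)ᵀ = B * E.Aoᵀ := by
  rw [Riccati.closedLoop, transpose_sub, transpose_mul, Matrix.mul_sub, ← Matrix.mul_assoc, h,
    Matrix.zero_mul, sub_zero]

lemma eq_qInf_of_fixedPoint {q : Fin N → ℝ} (hq : ∑ i, q i = 1)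
    {B : Matrix (Fin 2) (Fin 2 × Fin (N - 1)) ℝ} (h : B * E.Coᵀ = 0)
    {P : Matrix (Fin 2 × Fin (N - 1)) (Fin 2 × Fin (N - 1)) ℝ}
    (hB : B = clockA E.τ * B * (Riccati.closedLoop E.Ao E.Co E.R P)ᵀ + E.Qb (kronRow q)) :
    q = E.qInf := by
  rw [← E.vecMul_Sig₂_eq_zero_iff hq]
  ext j
  rw [Matrix.mul_assoc, mul_closedLoop_transpose_of_mul_Co_transpose_eq_zero E h] at hB
  -- Here the unknown entry of `B` cancels, leaving `τ` times the entry of `qᵀ Σ₂ Vᵀ`.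
  have h1 := congrFun (congrFun hB 1) (1, j)
  rw [Matrix.add_apply, Qb_apply E hq, Matrix.mul_apply, Fin.sum_univ_two,
    mul_Ao_transpose_apply, mul_Ao_transpose_apply] at h1
  simpa [clockA, E.τ_pos.ne'] using h1

/-- The stationary cross covariance for the weight `qInf`. -/
noncomputable def crossCovInf : Matrix (Fin 2) (Fin 2 × Fin (N - 1)) ℝ :=
  of fun i j => if i = 0 ∧ j.1 = 1 then -(E.qInf ᵥ* (E.Sig₁ * E.Vᵀ)) j.2 else 0

lemma crossCovInf_mul_Co_transpose : E.crossCovInf * E.Coᵀ = 0 := by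
  ext i j
  rw [mul_Co_transpose_apply]
  simp [crossCovInf]

/-- As `crossCovInf` is annihilated by `Coᵀ`, the gain, and with it `P`, drops out. Of `Qb` only `τ
qᵀ Σ₁ Vᵀ` survives, and `Aoᵀ` moves `τ` times the nonzero block onto it with the opposite sign. -/
lemma crossCovInf_fixedPoint (hq : ∑ i, E.qInf i = 1)
    (P : Matrix (Fin 2 × Fin (N - 1)) (Fin 2 × Fin (N - 1)) ℝ) :
    E.crossCovInf = clockA E.τ * E.crossCovInf * (Riccati.closedLoop E.Ao E.Co E.R P)ᵀ +
      E.Qb (kronRow E.qInf) := by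
  have h2 := (E.vecMul_Sig₂_eq_zero_iff hq).2 rfl
  rw [Matrix.mul_assoc, mul_closedLoop_transpose_of_mul_Co_transpose_eq_zero E
    E.crossCovInf_mul_Co_transpose]
  ext i ⟨a, j⟩
  rw [Matrix.add_apply, Qb_apply E hq, h2, Matrix.mul_apply, Fin.sum_univ_two,
    mul_Ao_transpose_apply, mul_Ao_transpose_apply]
  fin_cases i <;> fin_cases a <;> simp [crossCovInf, clockA]

/-- In the EEM basis the determinate filter has stationary covariances and gains. -/
theorem exists_isStationary {q : Fin N → ℝ} (hq : ∑ i, q i = 1)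
    {W : Matrix (Fin N) (Fin (N - 1)) ℝ} (hqW : q ᵥ* W = 0) :
    ∃ (P : ErrCov N) (Ho : Matrix (Fin 2 × Fin (N - 1)) (Fin (N - 1)) ℝ)
        (Hb : Matrix (Fin 2) (Fin (N - 1)) ℝ),
      E.IsStationary (kronI (E.Vplus W)) (kronRow q) P Ho Hb ∧
      (Hb = 0 ↔ q = E.qInf) ∧ (q = E.qInf → P.bo = E.crossCovInf) := by
  have hN : N ≠ 0 := by rintro rfl; simp at hq
  have hQ := E.Qo_posDef hN
  have hR := E.R_posDef
  have hK := E.deadbeat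
  obtain ⟨P, hP, hfix, hlim⟩ := Riccati.exists_tendsto_iterate hQ hR hK
  obtain ⟨B, hB⟩ :=
    Riccati.exists_crossCov_fixedPoint hQ hR hK hP hfix E.τ (E.Qb (kronRow q))
  have hoo : ∀ P₀ : ErrCov N, P₀.oo.PosSemidef →
      Tendsto (fun k => (E.prior (kronI (E.Vplus W)) (kronRow q) P₀ k).oo) atTop (𝓝 P) := by
    intro P₀ h
    simp only [prior_oo]
    exact hlim _ h.nonneg
  have hbo : ∀ P₀ : ErrCov N, P₀.oo.PosSemidef →
      Tendsto (fun k => (E.prior (kronI (E.Vplus W)) (kronRow q) P₀ k).bo) atTop (𝓝 B) :=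
    fun P₀ h => Riccati.tendsto_crossCov hQ hR hK hP h.nonneg (hlim _ h.nonneg) hB
      (E.prior_bo_succ (E.Ub_mul_bigA_mul_U hq hqW) P₀)
  have hfixed_unique : ∀ B', B' = clockA E.τ * B' *
      (Riccati.closedLoop E.Ao E.Co E.R P)ᵀ + E.Qb (kronRow q) → B' = B := by
    intro B' hB'
    -- Started at `P` and `B'`, the recursion is constant, yet it converges to `B`.
    refine tendsto_nhds_unique (tendsto_const_nhds (f := (atTop : Filter ℕ)))
      (Riccati.tendsto_crossCov (b := fun _ => B') hQ hR hK hP hP (hlim P hP) hB fun k => ?_)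
    rw [Function.iterate_fixed hfix]
    exact hB'
  have hS := Riccati.posDef_innovation (C := E.Co) hR hP
  have hbC : E.gainB ⟨P, B⟩ = 0 ↔ B * E.Coᵀ = 0 := by
    have hd := (Matrix.isUnit_iff_isUnit_det _).1 hS.isUnit
    refine ⟨fun h => ?_, fun h => ?_⟩
    · have := congrArg (· * (E.Co * P * E.Coᵀ + E.R)) h
      simpa only [gainB, nonsing_inv_mul_cancel_right _ _ hd, Matrix.zero_mul] using this
    · simp only [gainB, h, Matrix.zero_mul]
  have hinf : q = E.qInf → B = E.crossCovInf := by
    rintro rfl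
    exact (hfixed_unique _ (E.crossCovInf_fixedPoint hq P)).symm
  refine ⟨⟨P, B⟩, E.gainO ⟨P, B⟩, E.gainB ⟨P, B⟩, ⟨hoo, hbo, fun P₀ h => ?_, fun P₀ h => ?_⟩,
    ?_, hinf⟩
  · exact Riccati.tendsto_mul_inv_innovation hR hP (hoo P₀ h) (hoo P₀ h)
  · exact Riccati.tendsto_mul_inv_innovation hR hP (hbo P₀ h) (hoo P₀ h)
  · rw [hbC]
    refine ⟨fun h => E.eq_qInf_of_fixedPoint hq h hB, fun h => ?_⟩
    rw [hinf h, crossCovInf_mul_Co_transpose]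

end ClockEnsemble

/-! ### Allan variance -/

lemma integral_sum_mul_sq {Ω κ : Type*} [MeasurableSpace Ω] {μ : Measure Ω} [Fintype κ]
    {g : κ → Ω → ℝ} (hg : ∀ a, MemLp (g a) 2 μ) (c : κ → ℝ) :
    ∫ ω, (∑ a, c a * g a ω) ^ 2 ∂μ = ∑ a, ∑ b, c a * c b * ∫ ω, g a ω * g b ω ∂μ := by
  have hint : ∀ a b, Integrable (fun ω => g a ω * g b ω) μ := fun a b =>
    (hg a).integrable_mul (hg b)
  simp_rw [← integral_const_mul]
  have h1 : ∀ a, ∑ b, ∫ ω, c a * c b * (g a ω * g b ω) ∂μ =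
      ∫ ω, ∑ b, c a * c b * (g a ω * g b ω) ∂μ := fun a =>
    (integral_finsetSum _ fun b _ => (hint a b).const_mul _).symm
  simp_rw [h1]
  rw [← integral_finsetSum _ fun a _ =>
    integrable_finsetSum _ fun b _ => (hint a b).const_mul _]
  refine integral_congr_ae (Eventually.of_forall fun ω => ?_)
  simp only [sq, Finset.sum_mul_sum]
  exact Finset.sum_congr rfl fun a _ => Finset.sum_congr rfl fun b _ => by ring

/-- Expanding about the minimizer, whose product with `d i` is the same for all `i`, the linear term
vanishes by normalization. -/
lemma sum_mul_inv_div_sum_minimal {ι : Type*} [Fintype ι] {d : ι → ℝ} (hd : ∀ i, 0 < d i)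
    {p : ι → ℝ} (hp : ∑ i, p i = 1) (hne : p ≠ fun i => (d i)⁻¹ / ∑ j, (d j)⁻¹) :
    ∑ i, ((d i)⁻¹ / ∑ j, (d j)⁻¹) ^ 2 * d i < ∑ i, p i ^ 2 * d i := by
  set S := ∑ j, (d j)⁻¹
  obtain ⟨i₀, hi₀⟩ := Function.ne_iff.1 hne
  have hS : 0 < S := Finset.sum_pos (fun i _ => inv_pos.2 (hd i)) ⟨i₀, Finset.mem_univ _⟩
  have hq : ∑ i, (d i)⁻¹ / S = 1 := by rw [← Finset.sum_div, div_self hS.ne']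
  have key : ∑ i, p i ^ 2 * d i - ∑ i, ((d i)⁻¹ / S) ^ 2 * d i =
      ∑ i, (p i - (d i)⁻¹ / S) ^ 2 * d i + 2 / S * (∑ i, p i - ∑ i, (d i)⁻¹ / S) := by
    rw [← Finset.sum_sub_distrib, ← Finset.sum_sub_distrib, Finset.mul_sum,
      ← Finset.sum_add_distrib]
    refine Finset.sum_congr rfl fun i _ => ?_
    have := (hd i).ne'
    field_simp
    ring
  have hpos : 0 < ∑ i, (p i - (d i)⁻¹ / S) ^ 2 * d i := by
    refine Finset.sum_pos' (fun i _ => mul_nonneg (sq_nonneg _) (hd i).le)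
      ⟨i₀, Finset.mem_univ _, mul_pos (sq_pos_of_ne_zero (sub_ne_zero.2 hi₀)) (hd i₀)⟩
  rw [hp, hq, sub_self, mul_zero, add_zero] at key
  linarith

namespace ClockEnsemble

variable {N : ℕ} (E : ClockEnsemble N)

lemma allanVariance_eq {Ω : Type*} [MeasurableSpace Ω] {μ : Measure Ω} {t : ℝ} (ht : 0 < t)
    {v : ℤ → Ω → Fin 2 × Fin N → ℝ} (hv : IsWhiteNoise μ v (E.Q t)) {p : Fin N → ℝ}
    {r : ℤ → Ω → Fin 2 → ℝ} (hr : IsFreeRunning t p v r) (k : ℤ) :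
    allanVariance μ t r k =
      t / 3 * ∑ i, p i ^ 2 * (E.σ₂ i ^ 2 + 3 * E.σ₁ i ^ 2 / t ^ 2) := by
  let g : Fin 2 × Fin 2 × Fin N → Ω → ℝ := fun a ω => v (k + (a.1 : ℕ)) ω a.2
  -- The second difference is `pᵀ (v₁[k+1] - v₁[k] + t v₂[k])`, with `v₁`, `v₂` the two halves of
  -- the noise; rows of the matrix are times, columns halves.
  let c : Fin 2 × Fin 2 × Fin N → ℝ := fun a =>
    (!![-1, t; 1, 0] : Matrix (Fin 2) (Fin 2) ℝ) a.1 a.2.1 * p a.2.2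
  have hC : ∀ x : Fin 2 → ℝ, (clockC *ᵥ x) 0 = x 0 := fun x => by
    simp [clockC, mulVec, dotProduct, Fin.sum_univ_two]
  have hrow : ∀ k ω b, (kronRow p *ᵥ v k ω) b = ∑ l, p l * v k ω (b, l) := fun k ω b => by
    simp only [mulVec, dotProduct, Fintype.sum_prod_type, kronRow_apply, Fin.sum_univ_two]
    fin_cases b <;> simp
  have h0 : ∀ k ω, r (k + 1) ω 0 = r k ω 0 + t * r k ω 1 + ∑ l, p l * v k ω (0, l) :=
    fun k ω => by
      rw [hr k ω, Pi.add_apply, hrow]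
      simp [clockA, mulVec, dotProduct, Fin.sum_univ_two]
  have h1 : ∀ k ω, r (k + 1) ω 1 = r k ω 1 + ∑ l, p l * v k ω (1, l) := fun k ω => by
    rw [hr k ω, Pi.add_apply, hrow]
    simp [clockA, mulVec, dotProduct, Fin.sum_univ_two]
  have hdiff : ∀ ω, (clockC *ᵥ r (k + 2) ω) 0 - 2 * (clockC *ᵥ r (k + 1) ω) 0 +
      (clockC *ᵥ r k ω) 0 = ∑ a, c a * g a ω := by
    intro ω
    rw [hC, hC, hC, show k + 2 = k + 1 + 1 by ring, h0 (k + 1), h0 k, h1 k]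
    simp only [c, g, Fintype.sum_prod_type, Fin.sum_univ_two]
    simp [mul_assoc, ← Finset.mul_sum]
    ring
  have hgg : ∀ a b, ∫ ω, g a ω * g b ω ∂μ = if a.1 = b.1 then E.Q t a.2 b.2 else 0 := by
    intro a b
    split_ifs with h
    · simp only [g, h]; exact hv.cov_eq _ _ _
    · refine hv.uncorrelated _ _ (fun h' => h ?_) _ _
      exact Fin.ext (by exact_mod_cast add_left_cancel h')
  have hint := integral_sum_mul_sq (g := g) (fun a => hv.memLp _ _) c
  unfold allanVariance
  simp_rw [hdiff]
  rw [integral_div, hint]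
  have hQ : ∀ b b' l l', E.Q t (b, l) (b', l') = if l = l' then
      (!![t, 0; 0, 0] : Matrix (Fin 2) (Fin 2) ℝ) b b' * E.σ₁ l ^ 2 +
      (!![t ^ 3 / 3, t ^ 2 / 2; t ^ 2 / 2, t] : Matrix (Fin 2) (Fin 2) ℝ) b b' * E.σ₂ l ^ 2
      else 0 := fun b b' l l' => by
    simp only [Q, Sig₁, Sig₂, Matrix.add_apply, kroneckerMap_apply, diagonal_apply]
    split_ifs <;> simp
  simp_rw [hgg]
  simp only [Fintype.sum_prod_type, Fin.sum_univ_two, c, hQ, mul_ite, mul_zero,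
    Finset.sum_ite_eq, Finset.mem_univ, if_true, zero_ne_one, one_ne_zero, if_false,
    Finset.sum_const_zero]
  simp only [← Finset.sum_add_distrib]
  rw [Finset.sum_div, Finset.mul_sum]
  refine Finset.sum_congr rfl fun l _ => ?_
  simp
  field_simp
  ring

theorem isLongTermOptimal_qInf (hN : N ≠ 0) : E.IsLongTermOptimal.{u} E.qInf := by
  intro Ω _ μ _ v r hv hr
  -- The Allan variance of each clock without the common factor `t / 3`, so that it has a limit.
  let d : ℝ → Fin N → ℝ := fun t i => E.σ₂ i ^ 2 + 3 * E.σ₁ i ^ 2 / t ^ 2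
  have hd : ∀ t i, 0 < d t i := fun t i =>
    add_pos_of_pos_of_nonneg (pow_pos (E.σ₂_pos i) 2) (by positivity)
  have : Nonempty (Fin N) := ⟨⟨0, Nat.pos_of_ne_zero hN⟩⟩
  refine ⟨fun t i => (d t i)⁻¹ / ∑ j, (d t j)⁻¹, fun t ht => ⟨?_, fun p hp hne k => ?_⟩, ?_⟩
  · rw [← Finset.sum_div]
    exact div_self (Finset.sum_pos (fun i _ => inv_pos.2 (hd t i)) Finset.univ_nonempty).ne'
  · rw [E.allanVariance_eq ht (hv t ht) (hr t ht _), E.allanVariance_eq ht (hv t ht) (hr t ht _)]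
    exact mul_lt_mul_of_pos_left (sum_mul_inv_div_sum_minimal (hd t) hp hne) (by positivity)
  · refine tendsto_pi_nhds.2 fun l => ?_
    have hpos : ∀ i, E.σ₂ i ^ 2 ≠ 0 := fun i => (pow_pos (E.σ₂_pos i) 2).ne'
    have hlim : ∀ i, Tendsto (fun t => (d t i)⁻¹) atTop (𝓝 (E.σ₂ i ^ 2)⁻¹) := by
      intro i
      refine Tendsto.inv₀ ?_ (hpos i)
      have : Tendsto (fun t : ℝ => 3 * E.σ₁ i ^ 2 / t ^ 2) atTop (𝓝 0) :=
        (tendsto_pow_atTop two_ne_zero).const_div_atTop _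
      simpa using this.const_add (E.σ₂ i ^ 2)
    rw [qInf_apply]
    refine (hlim l).div (tendsto_finsetSum _ fun i _ => hlim i) ?_
    exact (Finset.sum_pos (fun i _ => inv_pos.2 (pow_pos (E.σ₂_pos i) 2))
      Finset.univ_nonempty).ne'

end ClockEnsemble

theorem theorem3 {N : ℕ} (E : ClockEnsemble N)
    (q : Fin N → ℝ) (hq : ∑ i, q i = 1)
    (W : Matrix (Fin N) (Fin (N - 1)) ℝ) (hW : LinearIndependent ℝ Wᵀ) (hqW : q ᵥ* W = 0) :
    (∃ (P : ErrCov N) (Ho : Matrix (Fin 2 × Fin (N - 1)) (Fin (N - 1)) ℝ)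
        (Hb : Matrix (Fin 2) (Fin (N - 1)) ℝ),
      E.IsStationary (kronI (E.Vplus W)) (kronRow q) P Ho Hb ∧
      (Hb = 0 ↔ q = E.qInf) ∧
      (q = E.qInf → P.bo = Matrix.of fun i j =>
        if i = 0 ∧ j.1 = 1 then -(E.qInf ᵥ* (E.Sig₁ * E.Vᵀ)) j.2 else 0)) ∧
    E.IsLongTermOptimal.{u} E.qInf := by
  have hN : N ≠ 0 := by rintro rfl; simp at hq
  exact ⟨E.exists_isStationary hq hqW, E.isLongTermOptimal_qInf hN⟩
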